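/- Let $V=(V,Y,\mathbf 1,\omega)$ be a vertex operator algebra over $\mathbb C$: a vertex algebra with a $\mathbb Z$-grading $V=\bigoplus_{n\in\mathbb Z}V_{(n)}$ such that $\dim V_{(n)}<\infty$ for all $n$ and $V_{(n)}=0$ for $n$ sufficiently negative, and with a conformal vector $\omega$ such that the operators $L(n)=\omega_{n+1}$ satisfy the Virasoro relations with some central charge $c\in\mathbb C$, $L(0)$ acts on $V_{(n)}$ as the scalar $n$, and $Y(L(-1)v,x)=\frac{d}{dx}Y(v,x)$ for $v\in V$. Let $\phi(x,z)=\frac{x}{1+zx}\in\mathbb C((x))[[z]]$, expanded in nonnegative powers of $z$. A module for $V$ viewed as a vertex algebra is a vector space $W$ with a linear map $Y_W(\cdot,x):V\to \mathrm{Hom}(W,W((x)))$ such that $Y_W(\mathbf 1,x)=1_W$ and, for all $u,v\in V$, the Jacobi identity $$x_0^{-1}\delta\Big(\frac{x_1-x_2}{x_0}\Big)Y_W(u,x_1)Y_W(v,x_2)-x_0^{-1}\delta\Big(\frac{x_2-x_1}{-x_0}\Big)Y_W(v,x_2)Y_W(u,x_1)=x_2^{-1}\delta\Big(\frac{x_1-x_0}{x_2}\Big)Y_W(Y(u,x_0)v,x_2)$$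 holds. A $\phi$-coordinated $V$-module is a vector space $W$ with a linear map $Y_W(\cdot,x):V\to \mathrm{Hom}(W,W((x)))$ such that $Y_W(\mathbf 1,x)=1_W$ and for all $u,v\in V$ there is $k\in\mathbb N$ with $$(x_1-x_2)^kY_W(u,x_1)Y_W(v,x_2)\in \mathrm{Hom}(W,W((x_1,x_2))),$$ $$\big((x_1-x_2)^kY_W(u,x_1)Y_W(v,x_2)\big)\big|_{x_1=\phi(x_2,z)}=(\phi(x_2,z)-x_2)^k\,Y_W(Y(u,z)v,x_2).$$ In both cases a homomorphism from $(W_1,Y_{W_1})$ to $(W_2,Y_{W_2})$ is a linear map $\theta:W_1\to W_2$ with $\theta(Y_{W_1}(v,x)w)=Y_{W_2}(v,x)\theta(w)$ for all $v\in V$, $w\in W_1$. Let $W$ be a vector space equipped with a linear map $Y_W(\cdot,x):V\to \mathrm{Hom}(W,W((x)))$ such that $Y_W(\mathbf 1,x)=1_W$. For $v\in V$ set $$Y_W^{new}(v,x)=Y_W\big(e^{xL(1)}(-x^{-2})^{L(0)}v,x\big).$$ Then $(W,Y_W)$ is a $\phi$-coordinated $V$-module if and only if $(W,Y_W^{new})$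 is a module for $V$ viewed as a vertex algebra. Furthermore, the assignment $(W,Y_W)\mapsto (W,Y_W^{new})$ on objects, together with $\theta\mapsto\theta$ on homomorphisms, is an isomorphism from the category of $\phi$-coordinated $V$-modules to the category of modules for $V$ viewed as a vertex algebra. -/

import Mathlib

open CategoryTheory

universe u v

noncomputable section

namespace VertexOp

/-! ### Vertex algebras, vertex operator algebras and modules

A linear map `V → Hom(W, W((x)))` is a linear map `V →ₗ[ℂ] VertexOperator ℂ W`.  For such a map `Y`
the operator `v_n`, that is, the coefficient of `x ^ (-n - 1)` in `Y(v, x)`, is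
`VertexOperator.ncoeff (Y v) n`, and the coefficient of `x ^ n` is `HVertexOperator.coeff (Y v) n`. -/

section Modules

variable {V : Type u} [AddCommGroup V] [Module ℂ V] {W : Type v} [AddCommGroup W] [Module ℂ W]

/-- `Y_W(e, x) = 1_W`. -/
def IsVacuum (e : V) (YW : V →ₗ[ℂ] VertexOperator ℂ W) : Prop :=
  ∀ n : ℤ, HVertexOperator.coeff (YW e) n = if n = 0 then LinearMap.id else 0

/-- The Jacobi identity
`x₀⁻¹ δ((x₁ - x₂)/x₀) Y_W(u, x₁) Y_W(v, x₂) - x₀⁻¹ δ((x₂ - x₁)/(-x₀)) Y_W(v, x₂) Y_W(u, x₁)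
  = x₂⁻¹ δ((x₁ - x₀)/x₂) Y_W(Y(u, x₀)v, x₂)`,
as the equality, on every vector `w`, of the coefficients of `x₀^(-l-1) x₁^(-m-1) x₂^(-n-1)`.
All the sums are finite, since `Y(u, x)v` and `Y_W(u, x)w` are truncated. -/
def JacobiIdentity (Y : V →ₗ[ℂ] VertexOperator ℂ V) (YW : V →ₗ[ℂ] VertexOperator ℂ W) : Prop :=
  ∀ (a b : V) (w : W) (l m n : ℤ),
    (∑ᶠ i : ℕ, ((-1 : ℂ) ^ i * ((Ring.choose l i : ℤ) : ℂ)) •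
        VertexOperator.ncoeff (YW a) (m + l - i) (VertexOperator.ncoeff (YW b) (n + i) w))
      - (∑ᶠ i : ℕ, ((-1 : ℂ) ^ l * (-1 : ℂ) ^ i * ((Ring.choose l i : ℤ) : ℂ)) •
        VertexOperator.ncoeff (YW b) (n + l - i) (VertexOperator.ncoeff (YW a) (m + i) w))
      = ∑ᶠ i : ℕ, ((Ring.choose m i : ℤ) : ℂ) •
        VertexOperator.ncoeff (YW (VertexOperator.ncoeff (Y a) (l + i) b)) (m + n - i) w

end Modules

/-- A vertex algebra structure on the complex vector space `V`. -/
structure VertexAlgebra (V : Type u) [AddCommGroup V] [Module ℂ V] where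
  /-- The vertex operator map `Y(·, x) : V → Hom(V, V((x)))`. -/
  Y : V →ₗ[ℂ] VertexOperator ℂ V
  /-- The vacuum vector. -/
  one : V
  vacuum : IsVacuum one Y
  /-- `Y(v, x)1 ∈ V[[x]]`. -/
  creation_regular : ∀ (a : V) (n : ℤ), n < 0 → HVertexOperator.coeff (Y a) n one = 0
  /-- The constant term of `Y(v, x)1` is `v`. -/
  creation_limit : ∀ a : V, HVertexOperator.coeff (Y a) 0 one = a
  jacobi : JacobiIdentity Y Y

/-- A vertex operator algebra structure on the complex vector space `V`; here `L(n) = ω_{n+1}`. -/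
structure VertexOperatorAlgebra (V : Type u) [AddCommGroup V] [Module ℂ V] extends
    VertexAlgebra V where
  /-- The conformal vector. -/
  ω : V
  /-- The central charge. -/
  c : ℂ
  /-- The homogeneous subspaces `V_(n)`. -/
  gr : ℤ → Submodule ℂ V
  isInternal : DirectSum.IsInternal gr
  finiteDimensional : ∀ n, FiniteDimensional ℂ (gr n)
  lower_truncation : ∃ N : ℤ, ∀ n < N, gr n = ⊥
  virasoro : ∀ m n : ℤ,
    ⁅VertexOperator.ncoeff (Y ω) (m + 1), VertexOperator.ncoeff (Y ω) (n + 1)⁆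
      = ((m : ℂ) - n) • VertexOperator.ncoeff (Y ω) (m + n + 1)
        + (if m + n = 0 then (((m : ℂ) ^ 3 - m) / 12 * c) • (1 : Module.End ℂ V) else 0)
  /-- `L(0)` acts on `V_(n)` as `n`. -/
  L_zero : ∀ (n : ℤ), ∀ a ∈ gr n, VertexOperator.ncoeff (Y ω) 1 a = (n : ℂ) • a
  /-- `Y(L(-1)v, x) = (d/dx) Y(v, x)`. -/
  L_neg_one : ∀ (a : V) (n : ℤ),
    HVertexOperator.coeff (Y (VertexOperator.ncoeff (Y ω) 0 a)) n
      = ((n : ℂ) + 1) • HVertexOperator.coeff (Y a) (n + 1)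

section Modules

variable {V : Type u} [AddCommGroup V] [Module ℂ V] {W : Type v} [AddCommGroup W] [Module ℂ W]

/-- `(W, Y_W)` is a module for the vertex algebra `V`. -/
structure IsModule (A : VertexAlgebra V) (YW : V →ₗ[ℂ] VertexOperator ℂ W) : Prop where
  vacuum : IsVacuum A.one YW
  jacobi : JacobiIdentity A.Y YW

/-! ### `φ`-coordinated modules

A doubly infinite series `∑ a_{m,n} x₁^m x₂^n` with coefficients in `W` is its coefficient function
`ℤ → ℤ → W`. -/

/-- `(x₁ - x₂)^k Y_W(a, x₁) Y_W(b, x₂) w`. -/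
def locProd (YW : V →ₗ[ℂ] VertexOperator ℂ W) (k : ℕ) (a b : V) (w : W) : ℤ → ℤ → W :=
  fun m n => ∑ i ∈ Finset.range (k + 1), ((-1 : ℂ) ^ i * (k.choose i : ℂ)) •
    HVertexOperator.coeff (YW a) (m - (k - i)) (HVertexOperator.coeff (YW b) (n - i) w)

/-- Membership in `W((x₁, x₂)) = W[[x₁, x₂]][x₁⁻¹, x₂⁻¹]`. -/
def IsLaurent₂ (A : ℤ → ℤ → W) : Prop :=
  ∃ N : ℤ, ∀ m n : ℤ, m < N ∨ n < N → A m n = 0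

/-- The variable `x` in `ℂ((x))`. -/
def xVar : LaurentSeries ℂ := HahnSeries.single 1 1

/-- The power `φ^m` in `ℂ((x))[[z]]`, for `φ` with `φ(x, 0) ≠ 0` and an integer `m`. -/
def zpowSeries (φ : PowerSeries (LaurentSeries ℂ)) : ℤ → PowerSeries (LaurentSeries ℂ)
  | Int.ofNat n => φ ^ n
  | Int.negSucc n => φ⁻¹ ^ (n + 1)

/-- The coefficient of `z^l x₂^p` in `A(x₁, x₂)|_{x₁ = φ(x₂, z)} = ∑ a_{m,n} φ(x₂, z)^m x₂^n`, for
`A ∈ W((x₁, x₂))`.  The sum is finite if `φ(x, 0) = x`. -/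
def substCoeff (φ : PowerSeries (LaurentSeries ℂ)) (A : ℤ → ℤ → W) (l p : ℤ) : W :=
  if 0 ≤ l then
    ∑ᶠ mn : ℤ × ℤ,
      (PowerSeries.coeff l.toNat (zpowSeries φ mn.1)).coeff (p - mn.2) • A mn.1 mn.2
  else 0

/-- The coefficient of `z^l x^p` in `ψ(x, z) Y_W(Y(a, z)b, x)w`, for `ψ ∈ ℂ((x))[[z]]`.  The sum is
finite: `Y(a, z)b ∈ V((z))` bounds `i`, and then `Y_W(c, x)w ∈ W((x))` bounds `j` for each `i`. -/
def iterCoeff (Y : V →ₗ[ℂ] VertexOperator ℂ V) (YW : V →ₗ[ℂ] VertexOperator ℂ W)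
    (ψ : PowerSeries (LaurentSeries ℂ)) (a b : V) (w : W) (l p : ℤ) : W :=
  ∑ᶠ ij : ℕ × ℤ, (PowerSeries.coeff ij.1 ψ).coeff ij.2 •
    HVertexOperator.coeff (YW (HVertexOperator.coeff (Y a) (l - ij.1) b)) (p - ij.2) w

/-- `(W, Y_W)` is a `φ`-coordinated module for the vertex algebra `V`, for a series
`φ(x, z) ∈ ℂ((x))[[z]]` with `φ(x, 0) = x` and `φ(φ(x, y), z) = φ(x, y + z)`. -/
structure IsPhiModule (φ : PowerSeries (LaurentSeries ℂ)) (A : VertexAlgebra V)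
    (YW : V →ₗ[ℂ] VertexOperator ℂ W) : Prop where
  vacuum : IsVacuum A.one YW
  assoc : ∀ a b : V, ∃ k : ℕ,
    (∀ w : W, IsLaurent₂ (locProd YW k a b w)) ∧
    ∀ (w : W) (l p : ℤ), substCoeff φ (locProd YW k a b w) l p
      = iterCoeff A.Y YW ((φ - PowerSeries.C xVar) ^ k) a b w l p

end Modules

/-- `φ(x, z) = x / (1 + zx)`, expanded in nonnegative powers of `z`. -/
def phi : PowerSeries (LaurentSeries ℂ) :=
  PowerSeries.C xVar * (1 + PowerSeries.X * PowerSeries.C xVar)⁻¹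

namespace VertexOperatorAlgebra

variable {V : Type u} [AddCommGroup V] [Module ℂ V] (A : VertexOperatorAlgebra V)

/-- `L(n) = ω_{n+1}`. -/
def L (n : ℤ) : Module.End ℂ V := VertexOperator.ncoeff (A.Y A.ω) (n + 1)

/-- The decomposition of a vector into its homogeneous components. -/
def decomp : V ≃ₗ[ℂ] DirectSum ℤ fun n => A.gr n :=
  (LinearEquiv.ofBijective (DirectSum.coeLinearMap A.gr) A.isInternal).symm

theorem decomp_symm_of (m : ℤ) (x : A.gr m) :
    A.decomp.symm (DirectSum.of (fun n => A.gr n) m x) = (x : V) :=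
  DirectSum.coeLinearMap_of A.gr m x

theorem mem_gr_of_L_zero {n : ℤ} {a : V} (h : A.L 0 a = (n : ℂ) • a) : a ∈ A.gr n := by
  classical
  have hL : ∀ d : DirectSum ℤ fun n => A.gr n, A.decomp (A.L 0 (A.decomp.symm d))
      = DirectSum.toModule ℂ ℤ _ (fun m => (m : ℂ) • DirectSum.lof ℂ ℤ (fun n => A.gr n) m) d := by
    intro d
    induction d using DirectSum.induction_on with
    | zero => simp
    | add x y hx hy => simp only [map_add, hx, hy]
    | of m x =>
      have h1 := A.decomp_symm_of m x
      have h2 : A.L 0 (x : V) = (m : ℂ) • (x : V) := by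
        simpa [L] using A.L_zero m x x.2
      rw [h1, h2, map_smul, ← h1, LinearEquiv.apply_symm_apply]
      change _ = DirectSum.toModule ℂ ℤ _ _ (DirectSum.lof ℂ ℤ (fun n => A.gr n) m x)
      rw [DirectSum.toModule_lof]
      rfl
  have hc : ∀ (d : DirectSum ℤ fun n => A.gr n) (k : ℤ),
      DirectSum.toModule ℂ ℤ (DirectSum ℤ fun n => A.gr n)
        (fun m => (m : ℂ) • DirectSum.lof ℂ ℤ (fun n => A.gr n) m) d k = (k : ℂ) • d k := by
    intro d k
    induction d using DirectSum.induction_on with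
    | zero => simp
    | add x y hx hy => simp only [map_add, DirectSum.add_apply, hx, hy, smul_add]
    | of m x =>
      change DirectSum.toModule ℂ ℤ (DirectSum ℤ fun n => A.gr n) _
        (DirectSum.lof ℂ ℤ (fun n => A.gr n) m x) k = _
      rw [DirectSum.toModule_lof]
      change (((m : ℂ) • DirectSum.of (fun n => A.gr n) m x : DirectSum ℤ fun n => A.gr n)) k = _
      rw [DirectSum.smul_apply]
      by_cases hk : m = k
      · subst hk; rfl
      · rw [DirectSum.of_eq_of_ne _ _ _ (Ne.symm hk)]; simp
  have h0 : ∀ k, k ≠ n → A.decomp a k = 0 := by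
    intro k hk
    have h1 := hL (A.decomp a)
    rw [LinearEquiv.symm_apply_apply, h, map_smul] at h1
    have h2 := congrArg (fun d => d k) h1
    simp only [hc, DirectSum.smul_apply] at h2
    rw [← sub_eq_zero, ← sub_smul] at h2
    refine (smul_eq_zero.1 h2).resolve_left ?_
    refine sub_ne_zero.2 ?_
    exact_mod_cast Ne.symm hk
  have h3 : A.decomp a = DirectSum.of (fun n => A.gr n) n (A.decomp a n) := by
    ext k
    by_cases hk : k = n
    · subst hk; simp
    · rw [h0 k hk, DirectSum.of_eq_of_ne _ _ _ hk]
  have h4 : a = ((A.decomp a n : A.gr n) : V) := by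
    conv_lhs => rw [← A.decomp.symm_apply_apply a, h3]
    rw [A.decomp_symm_of]
  rw [h4]
  exact (A.decomp a n).2

theorem L_one_mem {n : ℤ} {a : V} (h : a ∈ A.gr n) : A.L 1 a ∈ A.gr (n - 1) := by
  apply A.mem_gr_of_L_zero
  have h1 := congrArg (fun T : Module.End ℂ V => T a) (A.virasoro 0 1)
  have h2 : A.L 0 a = (n : ℂ) • a := by simpa [L] using A.L_zero n a h
  change ⁅A.L 0, A.L 1⁆ a = _ at h1
  rw [Ring.lie_def, LinearMap.sub_apply, Module.End.mul_apply, Module.End.mul_apply, h2,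
    map_smul] at h1
  have h3 : A.L 0 (A.L 1 a) - (n : ℂ) • A.L 1 a = - A.L 1 a := by
    simpa [L] using h1
  rw [sub_eq_iff_eq_add] at h3
  rw [h3]
  push_cast
  rw [sub_smul, one_smul]
  abel

theorem L_one_locally_nilpotent (a : V) : ∃ N : ℕ, ∀ j ≥ N, (A.L 1 ^ j) a = 0 := by
  classical
  obtain ⟨M, hM⟩ := A.lower_truncation
  rw [← A.decomp.symm_apply_apply a]
  induction A.decomp a using DirectSum.induction_on with
  | zero => exact ⟨0, by simp⟩
  | add x y hx hy =>
    obtain ⟨N₁, h₁⟩ := hx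
    obtain ⟨N₂, h₂⟩ := hy
    refine ⟨max N₁ N₂, fun j hj => ?_⟩
    rw [map_add, map_add, h₁ j (le_trans (le_max_left _ _) hj),
      h₂ j (le_trans (le_max_right _ _) hj), add_zero]
  | of m x =>
    have hx := A.decomp_symm_of m x
    have hj : ∀ j : ℕ, (A.L 1 ^ j) (x : V) ∈ A.gr (m - j) := by
      intro j
      induction j with
      | zero => simp
      | succ j ih =>
        rw [pow_succ', Module.End.mul_apply]
        have := A.L_one_mem ih
        rwa [show m - (j : ℤ) - 1 = m - ((j + 1 : ℕ) : ℤ) by push_cast; ring] at this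
    refine ⟨(m - M + 1).toNat, fun j h => ?_⟩
    have h1 := hj j
    rw [hM (m - j) (by omega)] at h1
    rw [hx]
    simpa using h1

theorem expL1_finite (a : V) : (Function.support fun j : ℕ =>
    Finsupp.single (j : ℤ) ((j.factorial : ℂ)⁻¹ • (A.L 1 ^ j) a)).Finite := by
  obtain ⟨N, hN⟩ := A.L_one_locally_nilpotent a
  refine (Set.finite_lt_nat N).subset fun j hj => ?_
  by_contra h
  exact hj (by simp [hN j (not_lt.1 h)])

/-- `e^{xL(1)} v = ∑_j (1/j!) x^j L(1)^j v`, a polynomial in `x` with coefficients in `V`.  An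
element of `V[x, x⁻¹]` is a finitely supported function `ℤ →₀ V`. -/
def expL1 : V →ₗ[ℂ] (ℤ →₀ V) where
  toFun a := ∑ᶠ j : ℕ, Finsupp.single (j : ℤ) ((j.factorial : ℂ)⁻¹ • (A.L 1 ^ j) a)
  map_add' a b := by
    rw [← finsum_add_distrib (A.expL1_finite a) (A.expL1_finite b)]
    simp only [map_add, smul_add, Finsupp.single_add]
  map_smul' r a := by
    simp only [RingHom.id_apply]
    rw [smul_finsum' r (A.expL1_finite a)]
    simp only [map_smul, smul_comm r, Finsupp.smul_single]

/-- `(-x⁻²)^{L(0)} v = ∑_n (-1)^n x^(-2n) v_(n)`, where `v_(n)` is the component of `v` of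
weight `n`. -/
def negInvSqPowL0 : V →ₗ[ℂ] (ℤ →₀ V) :=
  (DirectSum.toModule ℂ ℤ (ℤ →₀ V) fun n =>
    ((-1 : ℂ) ^ n) • (Finsupp.lsingle (-2 * n)).comp (A.gr n).subtype).comp A.decomp.toLinearMap

/-- `e^{xL(1)} (-x⁻²)^{L(0)} v`. -/
def Phi : V →ₗ[ℂ] (ℤ →₀ V) :=
  (Finsupp.lsum ℂ fun i : ℤ =>
    (Finsupp.lmapDomain V ℂ fun j : ℤ => i + j).comp A.expL1).comp A.negInvSqPowL0

/-- `Y_W^new(v, x) = Y_W(e^{xL(1)} (-x⁻²)^{L(0)} v, x)`: if the argument is `∑ a_i x^i`, this is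
`∑ x^i Y_W(a_i, x)`. -/
def newY {W : Type v} [AddCommGroup W] [Module ℂ W] (YW : V →ₗ[ℂ] VertexOperator ℂ W) :
    V →ₗ[ℂ] VertexOperator ℂ W :=
  (Finsupp.lsum ℂ fun i : ℤ =>
    (LinearMap.lsmul (LaurentSeries ℂ) (HahnModule ℤ ℂ W)
      (HahnSeries.single i 1) |>.restrictScalars ℂ).compRight ℂ ∘ₗ YW).comp A.Phi

end VertexOperatorAlgebra

/-! ### The categories of modules -/

/-- A vector space `W` with a linear map `Y_W(·, x) : V → Hom(W, W((x)))`. -/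
structure FieldSpace (V : Type u) [AddCommGroup V] [Module ℂ V] where
  /-- The underlying vector space. -/
  W : Type v
  [addCommGroup : AddCommGroup W]
  [module : Module ℂ W]
  /-- The vertex operator map. -/
  YW : V →ₗ[ℂ] VertexOperator ℂ W

attribute [instance] FieldSpace.addCommGroup FieldSpace.module

namespace FieldSpace

variable {V : Type u} [AddCommGroup V] [Module ℂ V]

/-- A homomorphism: a linear map `θ` with `θ(Y_W(v, x)w) = Y_{W'}(v, x)θ(w)`. -/
@[ext]
structure Hom (M N : FieldSpace.{u, v} V) where
  /-- The underlying linear map. -/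
  map : M.W →ₗ[ℂ] N.W
  comm : ∀ (a : V) (n : ℤ) (w : M.W),
    map (HVertexOperator.coeff (M.YW a) n w) = HVertexOperator.coeff (N.YW a) n (map w)

instance : Category (FieldSpace.{u, v} V) where
  Hom M N := Hom M N
  id M := { map := LinearMap.id, comm := fun _ _ _ => rfl }
  comp f g :=
    { map := g.map.comp f.map
      comm := fun a n w => by rw [LinearMap.comp_apply, f.comm, g.comm, LinearMap.comp_apply] }

end FieldSpace

variable {V : Type u} [AddCommGroup V] [Module ℂ V]

/-- The category of modules for the vertex algebra `V`. -/
abbrev ModCat (A : VertexAlgebra V) :=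
  ObjectProperty.FullSubcategory fun M : FieldSpace.{u, v} V => IsModule A M.YW

/-- The category of `φ`-coordinated modules for the vertex algebra `V`. -/
abbrev PhiModCat (φ : PowerSeries (LaurentSeries ℂ)) (A : VertexAlgebra V) :=
  ObjectProperty.FullSubcategory fun M : FieldSpace.{u, v} V => IsPhiModule φ A M.YW

theorem VertexOperatorAlgebra.coeff_newY (A : VertexOperatorAlgebra V) {W : Type v} [AddCommGroup W]
    [Module ℂ W] (YW : V →ₗ[ℂ] VertexOperator ℂ W) (a : V) (n : ℤ) (w : W) :
    HVertexOperator.coeff (A.newY YW a) n w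
      = (A.Phi a).sum fun i b => HVertexOperator.coeff (YW b) (n - i) w := by
  have h : ∀ (d : ℤ →₀ V), HVertexOperator.coeff ((Finsupp.lsum ℂ fun i : ℤ =>
      (LinearMap.lsmul (LaurentSeries ℂ) (HahnModule ℤ ℂ W)
        (HahnSeries.single i 1) |>.restrictScalars ℂ).compRight ℂ ∘ₗ YW) d) n w
      = d.sum fun i b => HVertexOperator.coeff (YW b) (n - i) w := by
    intro d
    induction d using Finsupp.induction_linear with
    | zero => simp
    | add f g hf hg =>
      rw [Finsupp.sum_add_index' (by simp) (by simp), map_add, map_add, ← hf, ← hg]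
      rfl
    | single i b =>
      rw [Finsupp.lsum_single, Finsupp.sum_single_index (by simp)]
      change ((HahnModule.of ℂ).symm (HahnSeries.single i (1 : ℂ) • (YW b w))).coeff n
        = ((HahnModule.of ℂ).symm (YW b w)).coeff (n - i)
      have := HahnModule.coeff_single_smul_vadd (r := (1 : ℂ)) (x := YW b w) (a := n - i) (b := i)
      simpa using this
  exact h (A.Phi a)

/-- The assignment `(W, Y_W) ↦ (W, Y_W^new)`, identical on linear maps. -/
def newFunctor (A : VertexOperatorAlgebra V) : FieldSpace.{u, v} V ⥤ FieldSpace.{u, v} V where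
  obj M := { W := M.W, YW := A.newY M.YW }
  map {M N} f :=
    { map := f.map
      comm := fun a n w => by
        simp only [A.coeff_newY, Finsupp.sum, map_sum, f.comm] }

end VertexOp

end

/-!
In the variable `y = x⁻¹` the substitution `x₁ = φ(x₂, z)` becomes the translation `y₁ = y₂ + z`, so
a `φ`-coordinated module satisfies the associativity of an ordinary module with respect to `y`.
Together with skew symmetry in `V`, this is equivalent to a Jacobi identity in `y` in which the two
products occur in the opposite order. The conjugation formula
`e^{tL(1)} Y(a, z) e^{-tL(1)} = Y(e^{t(1-tz)L(1)} (1-tz)^{-2L(0)} a, z/(1-tz))` shows that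
`e^{xL(1)} (-x⁻²)^{L(0)}` carries it to the ordinary Jacobi identity in `x`. The transformation is
inverted by the one with `x` replaced by `x⁻¹`, which makes the functor an isomorphism.
-/

namespace VertexOp

/-! ### Finite sums -/

section Finsum

variable {M : Type*} [AddCommMonoid M]

theorem hasFiniteSupport_of_le {f : ℕ → M} {N : ℕ} (h : ∀ i, N ≤ i → f i = 0) :
    f.HasFiniteSupport :=
  (Set.finite_lt_nat N).subset fun i hi => not_le.1 fun hc => hi (h i hc)

theorem finsum_eq_sum_range {f : ℕ → M} {N : ℕ} (h : ∀ i, N ≤ i → f i = 0) :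
    ∑ᶠ i, f i = ∑ i ∈ Finset.range N, f i :=
  finsum_eq_sum_of_support_subset f fun i hi => by
    simpa using not_le.1 fun hc => hi (h i hc)

theorem finsum_sum_antidiagonal {f : ℕ × ℕ → M} (hf : f.HasFiniteSupport) :
    ∑ᶠ n, ∑ ij ∈ Finset.HasAntidiagonal.antidiagonal n, f ij = ∑ᶠ ij, f ij := by
  have hsum : ∀ n, ∑ ij ∈ Finset.HasAntidiagonal.antidiagonal n, f ij
      = ∑ ij ∈ hf.toFinset with ij.1 + ij.2 = n, f ij := fun n =>
    Finset.sum_congr_of_eq_on_inter (fun ij hn h => by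
      by_contra hne
      exact h (Finset.mem_filter.2 ⟨hf.mem_toFinset.2 hne,
        Finset.HasAntidiagonal.mem_antidiagonal.1 hn⟩)) (fun ij _ h => by simp_all)
      fun _ _ _ => rfl
  rw [finsum_congr hsum, finsum_eq_sum f hf,
    finsum_eq_sum_of_support_subset (s := hf.toFinset.image fun ij => ij.1 + ij.2),
    Finset.sum_fiberwise_of_maps_to fun ij hij => Finset.mem_image_of_mem _ hij]
  intro n hn
  obtain ⟨ij, hij, -⟩ := Finset.exists_ne_zero_of_sum_ne_zero hn
  rw [Finset.mem_filter] at hij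
  exact Finset.mem_coe.2 (Finset.mem_image.2 ⟨ij, hij⟩)

theorem finsum_sum_antidiagonal_eq_finsum_finsum {f : ℕ × ℕ → M} (hf : f.HasFiniteSupport) :
    ∑ᶠ n, ∑ ij ∈ Finset.HasAntidiagonal.antidiagonal n, f ij = ∑ᶠ (i) (j), f (i, j) := by
  rw [finsum_sum_antidiagonal hf, finsum_curry f hf]

theorem finsum_comp_of_injective {ι κ : Type*} {f : κ → M} {e : ι → κ}
    (he : Function.Injective e) (h : f.support ⊆ Set.range e) :
    ∑ᶠ i, f (e i) = ∑ᶠ k, f k := by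
  rw [← finsum_mem_range (f := f) he, ← finsum_mem_univ f]
  refine finsum_mem_inter_support_eq f _ _ ?_
  rw [Set.univ_inter, Set.inter_eq_right.2 h]

theorem finsum_add_left {f : ℕ → M} {N : ℕ} (h : ∀ i < N, f i = 0) :
    ∑ᶠ i, f (N + i) = ∑ᶠ i, f i :=
  finsum_comp_of_injective (add_right_injective N) fun k hk =>
    ⟨k - N, Nat.add_sub_cancel' (not_lt.1 fun hc => hk (h k hc))⟩

theorem finsum_int_eq_add {f : ℤ → M} (hf : f.HasFiniteSupport) (m : ℤ) :
    ∑ᶠ k, f k = ∑ᶠ i : ℕ, f (m - 1 - i) + ∑ᶠ i : ℕ, f (m + i) := by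
  have hdown : Function.Injective fun i : ℕ => m - 1 - i := fun i j h => by grind
  have hup : Function.Injective fun i : ℕ => m + i := fun i j h => by grind
  have hdisj : Disjoint (Set.range fun i : ℕ => m - 1 - i) (Set.range fun i : ℕ => m + i) := by
    rw [Set.disjoint_left]
    rintro _ ⟨i, rfl⟩ ⟨j, h⟩
    dsimp only at h
    omega
  have huniv : (Set.range fun i : ℕ => m - 1 - i) ∪ (Set.range fun i : ℕ => m + i) = Set.univ := by
    refine Set.eq_univ_of_forall fun k => (lt_or_ge k m).imp (fun h => ?_) fun h => ?_
    · exact ⟨(m - 1 - k).toNat, by dsimp only; omega⟩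
    · exact ⟨(k - m).toNat, by dsimp only; omega⟩
  rw [← finsum_mem_univ, ← huniv, finsum_mem_union' hdisj (hf.subset Set.inter_subset_right)
    (hf.subset Set.inter_subset_right), finsum_mem_range hdown, finsum_mem_range hup]

/-- The sum over `i + j + s = N`. -/
def tripleSum (N : ℕ) (f : ℕ → ℕ → ℕ → M) : M :=
  ∑ it ∈ Finset.HasAntidiagonal.antidiagonal N,
    ∑ js ∈ Finset.HasAntidiagonal.antidiagonal it.2, f it.1 js.1 js.2

theorem tripleSum_add (N : ℕ) (f g : ℕ → ℕ → ℕ → M) :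
    tripleSum N (fun i j s => f i j s + g i j s) = tripleSum N f + tripleSum N g := by
  simp only [tripleSum, Finset.sum_add_distrib]

theorem tripleSum_succ_fst (N : ℕ) {f : ℕ → ℕ → ℕ → M} (h : ∀ j s, f 0 j s = 0) :
    tripleSum N (fun i => f (i + 1)) = tripleSum (N + 1) f := by
  simp only [tripleSum]
  rw [Finset.Nat.sum_antidiagonal_succ]
  simp only [h, Finset.sum_const_zero, zero_add]

theorem tripleSum_succ_snd (N : ℕ) {f : ℕ → ℕ → ℕ → M} (h : ∀ i s, f i 0 s = 0) :
    tripleSum N (fun i j => f i (j + 1)) = tripleSum (N + 1) f := by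
  simp only [tripleSum]
  rw [Finset.Nat.sum_antidiagonal_succ', Finset.Nat.antidiagonal_zero, Finset.sum_singleton, h,
    zero_add]
  refine Finset.sum_congr rfl fun it _ => ?_
  rw [Finset.Nat.sum_antidiagonal_succ, h, zero_add]

theorem tripleSum_succ_trd (N : ℕ) {f : ℕ → ℕ → ℕ → M} (h : ∀ i j, f i j 0 = 0) :
    tripleSum N (fun i j s => f i j (s + 1)) = tripleSum (N + 1) f := by
  simp only [tripleSum]
  rw [Finset.Nat.sum_antidiagonal_succ', Finset.Nat.antidiagonal_zero, Finset.sum_singleton, h,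
    zero_add]
  refine Finset.sum_congr rfl fun it _ => ?_
  rw [Finset.Nat.sum_antidiagonal_succ', h, zero_add]

theorem tripleSum_congr {N : ℕ} {f g : ℕ → ℕ → ℕ → M}
    (h : ∀ i j s, i + j + s = N → f i j s = g i j s) : tripleSum N f = tripleSum N g := by
  refine Finset.sum_congr rfl fun it hit => Finset.sum_congr rfl fun js hjs => h _ _ _ ?_
  rw [Finset.HasAntidiagonal.mem_antidiagonal] at hit hjs
  rw [← hit, ← hjs, add_assoc]

theorem map_tripleSum {M' F : Type*} [AddCommMonoid M'] [FunLike F M M'] [AddMonoidHomClass F M M']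
    (T : F) (N : ℕ) (f : ℕ → ℕ → ℕ → M) :
    T (tripleSum N f) = tripleSum N fun i j s => T (f i j s) := by
  simp only [tripleSum, map_sum]

theorem finsum_tripleSum {f : ℕ → ℕ → ℕ → M}
    (hf : (fun x : ℕ × ℕ × ℕ => f x.1 x.2.1 x.2.2).HasFiniteSupport) :
    ∑ᶠ N, tripleSum N f = ∑ᶠ (i) (j) (s), f i j s := by
  have hpartial : (fun it : ℕ × ℕ => ∑ js ∈ Finset.HasAntidiagonal.antidiagonal it.2,
      f it.1 js.1 js.2).HasFiniteSupport := by
    refine (hf.image fun x => (x.1, x.2.1 + x.2.2)).subset fun it hit => ?_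
    obtain ⟨js, hjs, hne⟩ := Finset.exists_ne_zero_of_sum_ne_zero hit
    exact ⟨(it.1, js), hne, Prod.ext rfl (Finset.HasAntidiagonal.mem_antidiagonal.1 hjs)⟩
  refine (finsum_sum_antidiagonal_eq_finsum_finsum hpartial).trans (finsum_congr fun i => ?_)
  exact finsum_sum_antidiagonal_eq_finsum_finsum (f := fun js => f i js.1 js.2)
    (hf.preimage (Prod.mk_right_injective i).injOn)

end Finsum

/-! ### Binomial coefficients -/

theorem choose_neg_eq (r : ℤ) (n : ℕ) :
    Ring.choose (-r) n = (-1) ^ n * Ring.choose (r + n - 1) n := by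
  rw [Ring.choose_neg, Units.smul_def, Int.coe_negOnePow_natCast, smul_eq_mul]

theorem choose_eq_choose_sub (r : ℤ) (n : ℕ) :
    Ring.choose r n = (-1) ^ n * Ring.choose (n - 1 - r) n := by
  rw [← neg_neg r, choose_neg_eq, neg_neg, neg_add_eq_sub, sub_right_comm]

theorem neg_one_pow_mul_choose_neg (r : ℤ) (n : ℕ) :
    (-1) ^ n * Ring.choose (-1 - r) n = Ring.choose (r + n) n := by
  rw [show -1 - r = -(r + 1) by ring, choose_neg_eq, ← mul_assoc, ← pow_add,
    Even.neg_one_pow ⟨n, rfl⟩, one_mul]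
  congr 1
  ring

theorem choose_eq_zero_of_lt {m : ℤ} {n : ℕ} (h0 : 0 ≤ m) (h : m < n) : Ring.choose m n = 0 := by
  lift m to ℕ using h0
  rw [Ring.choose_natCast, Nat.choose_eq_zero_of_lt (by omega), Nat.cast_zero]

/-- The binomial coefficient `x.choose l`, extended by `0` to negative `l`. -/
def bin (x l : ℤ) : ℤ := if 0 ≤ l then Ring.choose x l.toNat else 0

theorem bin_natCast (x : ℤ) (l : ℕ) : bin x l = Ring.choose x l := by simp [bin]

theorem bin_of_neg (x : ℤ) {l : ℤ} (h : l < 0) : bin x l = 0 := by simp [bin, h]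

theorem bin_succ (x l : ℤ) : bin (x + 1) l = bin x (l - 1) + bin x l := by
  rcases lt_trichotomy l 0 with h | rfl | h
  · rw [bin_of_neg _ h, bin_of_neg _ h, bin_of_neg _ (by omega), add_zero]
  · simp [bin]
  · obtain ⟨n, rfl⟩ : ∃ n : ℕ, l = (n + 1 : ℕ) := ⟨(l - 1).toNat, by omega⟩
    rw [bin_natCast, bin_natCast, Nat.cast_succ, add_sub_cancel_right, bin_natCast,
      Ring.choose_succ_succ]

theorem bin_add (x y l : ℤ) : bin (x + y) l = ∑ᶠ i : ℕ, Ring.choose x i * bin y (l - i) := by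
  rcases lt_or_ge l 0 with h | h
  · rw [bin_of_neg _ h, finsum_eq_zero_of_forall_eq_zero fun i => ?_]
    rw [bin_of_neg _ (by omega), mul_zero]
  · lift l to ℕ using h
    rw [bin_natCast, Ring.add_choose_eq l (Commute.all x y),
      finsum_eq_sum_range (N := l + 1) fun i hi => by rw [bin_of_neg _ (by omega), mul_zero],
      Finset.Nat.sum_antidiagonal_eq_sum_range_succ
        (f := fun i j => Ring.choose x i * Ring.choose y j)]
    refine Finset.sum_congr rfl fun i hi => ?_
    rw [← Nat.cast_sub (Finset.mem_range_succ_iff.1 hi), bin_natCast]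

theorem mul_bin (x l : ℤ) : l * bin x l = (x - l + 1) * bin x (l - 1) := by
  rcases lt_trichotomy l 0 with h | rfl | h
  · rw [bin_of_neg _ h, bin_of_neg _ (by omega), mul_zero, mul_zero]
  · simp [bin]
  · obtain ⟨n, rfl⟩ : ∃ n : ℕ, l = (n + 1 : ℕ) := ⟨(l - 1).toNat, by omega⟩
    have h := Ring.choose_smul_choose x (Nat.le_succ n)
    rw [Nat.succ_eq_add_one, Nat.choose_succ_self_right, Nat.add_sub_cancel_left,
      Ring.choose_one_right, nsmul_eq_mul] at h
    rw [bin_natCast, Nat.cast_succ, add_sub_cancel_right, bin_natCast, ← Nat.cast_succ, h]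
    push_cast
    ring

theorem sum_choose_mul_choose_sub (m P : ℤ) (R : ℕ) :
    ∑ rs ∈ Finset.HasAntidiagonal.antidiagonal R,
      (-1) ^ rs.1 * Ring.choose m rs.1 * Ring.choose (P - rs.1) rs.2
    = Ring.choose (P - m) R := by
  rw [choose_eq_choose_sub (P - m), show (R : ℤ) - 1 - (P - m) = m + (R - 1 - P) by ring,
    Ring.add_choose_eq _ (Commute.all _ _), Finset.mul_sum]
  refine Finset.sum_congr rfl fun rs hrs => ?_
  rw [Finset.HasAntidiagonal.mem_antidiagonal] at hrs
  rw [choose_eq_choose_sub (P - rs.1), ← hrs, pow_add, Nat.cast_add,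
    show (rs.2 : ℤ) - 1 - (P - rs.1) = rs.1 + rs.2 - 1 - P by ring]
  ring

theorem finsum_choose_smul_finsum_choose_smul {M : Type*} [AddCommGroup M] (m P : ℤ) {H : ℕ → M}
    {S : ℕ} (hH : ∀ R, S ≤ R → H R = 0) :
    ∑ᶠ r : ℕ, ((-1) ^ r * Ring.choose m r) • ∑ᶠ s : ℕ, Ring.choose (P - r) s • H (r + s)
      = ∑ᶠ R : ℕ, Ring.choose (P - m) R • H R := by
  have hfin : (fun rs : ℕ × ℕ => ((-1) ^ rs.1 * Ring.choose m rs.1 * Ring.choose (P - rs.1) rs.2)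
      • H (rs.1 + rs.2)).HasFiniteSupport := by
    refine ((Set.finite_lt_nat S).prod (Set.finite_lt_nat S)).subset fun rs hrs => ?_
    have hlt : rs.1 + rs.2 < S := not_le.1 fun h => hrs (by dsimp only; rw [hH _ h, smul_zero])
    exact ⟨(Nat.le_add_right _ _).trans_lt hlt, (Nat.le_add_left _ _).trans_lt hlt⟩
  simp only [← sum_choose_mul_choose_sub m P, Finset.sum_smul]
  refine Eq.trans ?_ ((finsum_sum_antidiagonal_eq_finsum_finsum hfin).symm.trans
    (finsum_congr fun R => Finset.sum_congr rfl fun rs hrs => ?_))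
  · refine finsum_congr fun r => ?_
    rw [smul_finsum' _ (hasFiniteSupport_of_le (N := S) fun s hs => by
      rw [hH _ (hs.trans (Nat.le_add_left _ _)), smul_zero])]
    simp only [smul_smul]
  · rw [Finset.HasAntidiagonal.mem_antidiagonal.1 hrs]

/-! ### Expansions of `(y₁ - y₂) ^ L` -/

section Expand

variable {M : Type*} [AddCommGroup M]

/-- The coefficients of `(y₁ - y₂)^L β`, where `y = x⁻¹` and `(y₁ - y₂)^L` is expanded in
nonnegative powers of `y₂`.  All coefficient functions are indexed by powers of `x₁`, `x₂`. -/
noncomputable def expand (L : ℤ) (β : ℤ → ℤ → M) : ℤ → ℤ → M := fun m n =>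
  ∑ᶠ i : ℕ, ((-1) ^ i * Ring.choose L i : ℤ) • β (m + L - i) (n + i)

theorem expand_zero (β : ℤ → ℤ → M) : expand 0 β = β := by
  funext m n
  rw [expand, finsum_eq_sum_range (N := 1) fun i hi => by
    rw [choose_eq_zero_of_lt le_rfl (by omega), mul_zero, zero_smul]]
  simp

theorem expand_expand (L K : ℤ) {β : ℤ → ℤ → M} {N : ℤ} (h : ∀ m n, m < N → β m n = 0) :
    expand L (expand K β) = expand (L + K) β := by
  funext m n
  let f : ℕ × ℕ → M := fun ij => ((-1) ^ (ij.1 + ij.2) * (Ring.choose L ij.1 * Ring.choose K ij.2))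
    • β (m + (L + K) - (ij.1 + ij.2 : ℕ)) (n + (ij.1 + ij.2 : ℕ))
  have hf : f.HasFiniteSupport := by
    let B := (m + (L + K) - N + 1).toNat
    refine ((Set.finite_lt_nat B).prod (Set.finite_lt_nat B)).subset fun ij hij => ?_
    by_contra hc
    refine hij ?_
    simp only [Set.mem_prod, Set.mem_ofPred_eq, not_and_or, not_lt] at hc
    rw [show f ij = 0 from by simp only [f]; rw [h _ _ (by omega), smul_zero]]
  calc expand L (expand K β) m n = ∑ᶠ (i) (j), f (i, j) := finsum_congr fun i => by
        rw [expand, smul_finsum' _ (hasFiniteSupport_of_le (N := (m + (L + K) - N + 1).toNat)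
          fun j hj => by rw [h _ _ (by omega), smul_zero])]
        refine finsum_congr fun j => ?_
        simp only [f, smul_smul, Nat.cast_add]
        congr 1
        · ring
        · congr 1 <;> ring
    _ = ∑ᶠ k, ∑ ij ∈ Finset.HasAntidiagonal.antidiagonal k, f ij :=
        (finsum_sum_antidiagonal_eq_finsum_finsum hf).symm
    _ = expand (L + K) β m n := finsum_congr fun k => by
        rw [Ring.add_choose_eq k (Commute.all L K), Finset.mul_sum, Finset.sum_smul]
        refine Finset.sum_congr rfl fun ij hij => ?_
        rw [← Finset.HasAntidiagonal.mem_antidiagonal.1 hij]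

theorem expand_natCast (k : ℕ) (β : ℤ → ℤ → M) (m n : ℤ) : expand k β m n
    = ∑ i ∈ Finset.range (k + 1), ((-1) ^ i * (k.choose i) : ℤ) • β (m + k - i) (n + i) := by
  rw [expand, finsum_eq_sum_range (N := k + 1) fun i hi => by
    rw [choose_eq_zero_of_lt (Int.natCast_nonneg k) (by omega), mul_zero, zero_smul]]
  simp only [Ring.choose_natCast]

theorem expand_succ (k : ℕ) (β : ℤ → ℤ → M) (m n : ℤ) :
    expand (k + 1 : ℕ) β m n = expand k β (m + 1) n - expand k β m (n + 1) := by
  have hlast : expand k β (m + 1) n = ∑ i ∈ Finset.range (k + 2),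
      ((-1) ^ i * (k.choose i) : ℤ) • β (m + 1 + k - i) (n + i) := by
    rw [expand_natCast, Finset.sum_range_succ _ (k + 1), Nat.choose_succ_self, Nat.cast_zero,
      mul_zero, zero_smul, add_zero]
  rw [hlast, expand_natCast, expand_natCast, Finset.sum_range_succ' _ (k + 1),
    Finset.sum_range_succ' _ (k + 1), add_sub_right_comm (Finset.sum _ _),
    ← Finset.sum_sub_distrib]
  congr 1
  · refine Finset.sum_congr rfl fun i _ => ?_
    rw [Nat.choose_succ_succ, show m + ((k + 1 : ℕ) : ℤ) - ((i + 1 : ℕ) : ℤ) = m + k - i by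
      push_cast; ring, show m + 1 + (k : ℤ) - ((i + 1 : ℕ) : ℤ) = m + k - i by push_cast; ring,
      show n + ((i + 1 : ℕ) : ℤ) = n + 1 + i by push_cast; ring, ← sub_smul]
    congr 1
    push_cast
    ring
  · simp [add_right_comm, add_assoc]

/-- Exchange of the two variables. -/
def swap (β : ℤ → ℤ → M) : ℤ → ℤ → M := fun m n => β n m

theorem expand_natCast_swap (k : ℕ) (β : ℤ → ℤ → M) (m n : ℤ) :
    expand k (swap β) n m = ((-1) ^ k : ℤ) • expand k β m n := by
  rw [expand_natCast, expand_natCast, ← Finset.sum_range_reflect, Finset.smul_sum]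
  refine Finset.sum_congr rfl fun i hi => ?_
  obtain ⟨j, rfl⟩ := Nat.exists_eq_add_of_le (Finset.mem_range_succ_iff.1 hi)
  rw [show i + j + 1 - 1 - i = j by omega, smul_smul, swap, Nat.choose_symm_add, pow_add,
    show m + ((i + j : ℕ) : ℤ) - i = m + j by push_cast; ring,
    show n + ((i + j : ℕ) : ℤ) - j = n + i by push_cast; ring, ← mul_assoc,
    mul_right_comm _ ((-1 : ℤ) ^ j), ← pow_add, Even.neg_one_pow ⟨i, rfl⟩, one_mul]

theorem expand_zsmul (L c : ℤ) {β : ℤ → ℤ → M} {N : ℤ} (h : ∀ m n, m < N → β m n = 0) :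
    expand L (fun m n => c • β m n) = fun m n => c • expand L β m n := by
  funext m n
  rw [expand, expand, smul_finsum' _ (hasFiniteSupport_of_le (N := (m + L - N + 1).toNat)
    fun i hi => by rw [h _ _ (by omega), smul_zero])]
  exact finsum_congr fun i => smul_comm _ _ _

theorem expand_neg (j : ℕ) (β : ℤ → ℤ → M) (m n : ℤ) : expand (-1 - j) β m n
    = ∑ᶠ i : ℕ, Ring.choose (i : ℤ) j • β (m - 1 - i) (n - j + i) := by
  rw [expand, ← finsum_add_left (N := j) (f := fun i : ℕ => Ring.choose (i : ℤ) j
    • β (m - 1 - i) (n - j + i)) fun i hi => by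
      rw [choose_eq_zero_of_lt (Int.natCast_nonneg i) (by omega), zero_smul]]
  refine finsum_congr fun i => ?_
  rw [neg_one_pow_mul_choose_neg, ← Nat.cast_add, Ring.choose_natCast, Ring.choose_natCast,
    Nat.choose_symm_add]
  congr 2 <;> push_cast <;> ring

theorem expand_neg_swap (j : ℕ) (β : ℤ → ℤ → M) (m n : ℤ) : expand (-1 - j) (swap β) n m
    = ∑ᶠ i : ℕ, ((-1) ^ j * Ring.choose (-1 - i : ℤ) j) • β (m + i) (n - j - 1 - i) := by
  rw [expand]
  refine finsum_congr fun i => ?_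
  rw [neg_one_pow_mul_choose_neg, neg_one_pow_mul_choose_neg, ← Nat.cast_add, ← Nat.cast_add,
    Ring.choose_natCast, Ring.choose_natCast, add_comm j i, Nat.choose_symm_add, swap]
  congr 2
  ring

theorem IsLaurent₂.hasFiniteSupport {A : ℤ → ℤ → M} (hA : IsLaurent₂ A) (c : ℤ → ℤ) (s : ℤ) :
    (fun μ : ℤ => c μ • A μ (s - μ)).HasFiniteSupport := by
  obtain ⟨N, hN⟩ := hA
  refine (Set.finite_Icc N (s - N)).subset fun μ hμ => ?_
  by_contra hc
  refine hμ ?_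
  simp only [Set.mem_Icc, not_and_or, not_le] at hc
  dsimp only
  rw [hN _ _ (by omega), smul_zero]

/-- The two expansions of `(y₁ - y₂)^d` differ by a derivative of the `δ`-function, and so act on
`A` through its restriction to `y₁ = y₂ + z`. -/
theorem IsLaurent₂.expand_sub_expand_swap {A : ℤ → ℤ → M} (hA : IsLaurent₂ A) (d m n : ℤ) :
    expand d A m n - (d.negOnePow : ℤ) • expand d (swap A) n m
      = ∑ᶠ μ : ℤ, bin (m - 1 - μ) (-1 - d) • A μ (m + n + d - μ) := by
  rcases lt_or_ge d 0 with hd | hd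
  · obtain ⟨j, rfl⟩ : ∃ j : ℕ, d = -1 - j := ⟨(-1 - d).toNat, by omega⟩
    have hfin : (fun i : ℕ => ((-1) ^ j * Ring.choose (-1 - i : ℤ) j)
        • A (m + i) (n - j - 1 - i)).HasFiniteSupport := by
      obtain ⟨N, hN⟩ := hA
      exact hasFiniteSupport_of_le (N := (n - j - N).toNat) fun i hi => by
        rw [hN _ _ (by omega), smul_zero]
    have hsign : ((-1 - j : ℤ).negOnePow : ℤ) = -(-1) ^ j := by
      rw [← Int.negOnePow_neg, show -(-1 - j : ℤ) = (j : ℤ) + 1 by ring, Int.negOnePow_succ,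
        Units.val_neg, Int.coe_negOnePow_natCast]
    rw [finsum_int_eq_add (hA.hasFiniteSupport _ _) m, sub_sub_cancel, hsign, neg_smul,
      sub_neg_eq_add, expand_neg, expand_neg_swap, smul_finsum' _ hfin]
    congr 1 <;> refine finsum_congr fun i => ?_
    · rw [bin_natCast]
      congr 2 <;> ring
    · rw [smul_smul, ← mul_assoc, ← pow_add, Even.neg_one_pow ⟨j, rfl⟩, one_mul, bin_natCast]
      congr 2 <;> ring
  · lift d to ℕ using hd
    rw [expand_natCast_swap, smul_smul, Int.coe_negOnePow_natCast, ← pow_add,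
      Even.neg_one_pow ⟨d, rfl⟩, one_smul, sub_self,
      finsum_eq_zero_of_forall_eq_zero fun μ => ?_]
    rw [bin_of_neg _ (by omega), zero_smul]

theorem isLaurent₂_of_expand_eq {α β : ℤ → ℤ → M} {N : ℤ} (hα : ∀ m n, n < N → α m n = 0)
    (hβ : ∀ m n, m < N → β m n = 0) {k : ℕ} (h : expand k α = expand k β) :
    IsLaurent₂ (expand k α) := by
  refine ⟨N - k, fun m n hmn => ?_⟩
  rcases hmn with hm | hn
  · rw [h, expand_natCast]
    exact Finset.sum_eq_zero fun i _ => by rw [hβ _ _ (by omega), smul_zero]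
  · rw [expand_natCast]
    refine Finset.sum_eq_zero fun i hi => ?_
    rw [Finset.mem_range] at hi
    rw [hα _ _ (by omega), smul_zero]

theorem expand_sub_expand_swap {α β : ℤ → ℤ → M} {N : ℤ} (hα : ∀ m n, n < N → α m n = 0)
    (hβ : ∀ m n, m < N → β m n = 0) {k : ℕ} (h : expand k α = expand k β) (l m n : ℤ) :
    expand l β m n - (l.negOnePow : ℤ) • expand l (swap α) n m
      = ∑ᶠ μ : ℤ, bin (m - 1 - μ) (k - 1 - l) • expand k α μ (m + n - 1 - (k - 1 - l) - μ) := by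
  have hA := isLaurent₂_of_expand_eq hα hβ h
  obtain ⟨d, rfl⟩ : ∃ d, l = d + k := ⟨l - k, by ring⟩
  have hβA : expand (d + k) β = expand d (expand k α) := by rw [← expand_expand d k hβ, ← h]
  have hαA : expand (d + k) (swap α) n m
      = ((-1) ^ k : ℤ) • expand d (swap (expand k α)) n m := by
    have hswap : expand k (swap α) = fun n m => ((-1) ^ k : ℤ) • swap (expand k α) n m :=
      funext₂ fun n m => expand_natCast_swap k α m n
    obtain ⟨N', hN'⟩ := hA
    rw [← expand_expand d k (N := N) (β := swap α) fun m n hm => hα n m hm, hswap,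
      expand_zsmul d _ (N := N') (β := swap (expand k α)) fun n m hn => hN' m n (Or.inr hn)]
  have hsign : ((d + k).negOnePow : ℤ) * (-1) ^ k = d.negOnePow := by
    rw [Int.negOnePow_add, Units.val_mul, Int.coe_negOnePow_natCast, mul_assoc, ← pow_add,
      Even.neg_one_pow ⟨k, rfl⟩, mul_one]
  rw [hβA, hαA, smul_smul, hsign, hA.expand_sub_expand_swap, show (k : ℤ) - 1 - (d + k) = -1 - d by
    ring, show m + n - 1 - (-1 - d) = m + n + d by ring]

end Expand

section Moment

variable {M : Type*} [AddCommGroup M]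

/-- The coefficient of `z^l x₂^p` in `A(x₁, x₂)|_{y₁ = y₂ + z}`, where `y = x⁻¹`. -/
noncomputable def moment (A : ℤ → ℤ → M) (l p : ℤ) : M :=
  ∑ᶠ μ : ℤ, bin (-μ) l • A μ (p - l - μ)

theorem moment_of_neg (A : ℤ → ℤ → M) {l : ℤ} (hl : l < 0) (p : ℤ) : moment A l p = 0 :=
  finsum_eq_zero_of_forall_eq_zero fun μ => by rw [bin_of_neg _ hl, zero_smul]

theorem IsLaurent₂.finsum_bin_sub {A : ℤ → ℤ → M} (hA : IsLaurent₂ A) (r j s : ℤ) :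
    ∑ᶠ μ : ℤ, bin (r - μ) j • A μ (s - μ)
      = ∑ᶠ i : ℕ, Ring.choose r i • moment A (j - i) (s + j - i) := by
  have hbin : ∀ μ : ℤ, bin (r - μ) j • A μ (s - μ) = ∑ i ∈ Finset.range (j.toNat + 1),
      (Ring.choose r i * bin (-μ) (j - i)) • A μ (s - μ) := fun μ => by
    rw [sub_eq_add_neg r, bin_add, finsum_eq_sum_range (N := j.toNat + 1) fun i hi => by
      rw [bin_of_neg _ (by omega), mul_zero], Finset.sum_smul]
  rw [finsum_eq_sum_range (N := j.toNat + 1) fun i hi => by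
    rw [moment_of_neg _ (by omega), smul_zero], finsum_congr hbin,
    finsum_sum_comm _ _ fun i _ => hA.hasFiniteSupport _ _]
  refine Finset.sum_congr rfl fun i _ => ?_
  rw [moment, smul_finsum' _ (hA.hasFiniteSupport _ _)]
  refine finsum_congr fun μ => ?_
  rw [mul_smul, show s + j - i - (j - i) - μ = s - μ by ring]

theorem IsLaurent₂.expand_succ {β : ℤ → ℤ → M} {k : ℕ} (h : IsLaurent₂ (expand k β)) :
    IsLaurent₂ (expand (k + 1 : ℕ) β) := by
  obtain ⟨N, hN⟩ := h
  refine ⟨N - 1, fun m n hmn => ?_⟩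
  rw [VertexOp.expand_succ, hN _ _ (by omega), hN _ _ (by omega), sub_zero]

theorem IsLaurent₂.moment_expand_succ {β : ℤ → ℤ → M} {k : ℕ} (h : IsLaurent₂ (expand k β))
    (l p : ℤ) : moment (expand (k + 1 : ℕ) β) l p = moment (expand k β) (l - 1) p := by
  let g : ℤ → M := fun μ => bin (1 - μ) l • expand k β μ (p - l + 1 - μ)
  have hg : g.HasFiniteSupport := h.hasFiniteSupport _ _
  have hterm : ∀ μ : ℤ, bin (-μ) l • expand (k + 1 : ℕ) β μ (p - l - μ)
      = g (μ + 1) - bin (-μ) l • expand k β μ (p - l + 1 - μ) := fun μ => by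
    simp only [g]
    rw [VertexOp.expand_succ, smul_sub, show p - l + 1 - (μ + 1) = p - l - μ by ring,
      show p - l + 1 - μ = p - l - μ + 1 by ring, show 1 - (μ + 1) = -μ by ring]
  have hshift : ∑ᶠ μ, g (μ + 1) = ∑ᶠ μ, g μ := finsum_comp_equiv (Equiv.addRight (1 : ℤ))
  rw [moment, finsum_congr hterm, finsum_sub_distrib
    (hg.fun_comp_of_injective (add_left_injective (1 : ℤ))) (h.hasFiniteSupport _ _), hshift,
    ← finsum_sub_distrib hg (h.hasFiniteSupport _ _), moment]
  refine finsum_congr fun μ => ?_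
  simp only [g]
  rw [← sub_smul, show 1 - μ = -μ + 1 by ring, bin_succ, add_sub_cancel_right,
    show p - (l - 1) - μ = p - l + 1 - μ by ring]

theorem IsLaurent₂.swap {A : ℤ → ℤ → M} (hA : IsLaurent₂ A) : IsLaurent₂ (swap A) := by
  obtain ⟨N, hN⟩ := hA
  exact ⟨N, fun m n h => hN n m h.symm⟩

theorem IsLaurent₂.zsmul {A : ℤ → ℤ → M} (hA : IsLaurent₂ A) (c : ℤ) : IsLaurent₂ (c • A) := by
  obtain ⟨N, hN⟩ := hA
  exact ⟨N, fun m n h => by rw [Pi.smul_apply, Pi.smul_apply, hN m n h, smul_zero]⟩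

theorem IsLaurent₂.moment_zsmul {A : ℤ → ℤ → M} (hA : IsLaurent₂ A) (c l p : ℤ) :
    moment (c • A) l p = c • moment A l p := by
  rw [moment, moment, smul_finsum' _ (hA.hasFiniteSupport _ _)]
  exact finsum_congr fun μ => by rw [Pi.smul_apply, Pi.smul_apply, smul_comm]

theorem IsLaurent₂.moment_swap {A : ℤ → ℤ → M} (hA : IsLaurent₂ A) (l : ℕ) (p : ℤ) :
    moment (VertexOp.swap A) l p
      = ((-1) ^ l : ℤ) • ∑ᶠ i : ℕ, Ring.choose (p - 1) i • moment A (l - i) (p - i) := by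
  have hbin := hA.finsum_bin_sub (p - 1) l (p - l)
  simp only [sub_add_cancel] at hbin
  rw [← hbin, smul_finsum' _ (hA.hasFiniteSupport _ _), moment,
    ← finsum_comp_equiv (Equiv.subLeft (p - l))]
  refine finsum_congr fun μ => ?_
  rw [Equiv.subLeft_apply, VertexOp.swap, sub_sub_cancel, smul_smul, bin_natCast, bin_natCast,
    choose_eq_choose_sub, show (l : ℤ) - 1 - -(p - l - μ) = p - 1 - μ by ring]

theorem eq_zero_of_finsum_bin_sub {f : ℤ → M} (hf : f.HasFiniteSupport)
    (h : ∀ r j, ∑ᶠ μ : ℤ, bin (r - μ) j • f μ = 0) : f = 0 := by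
  by_contra hne
  have hnonempty : hf.toFinset.Nonempty := by
    obtain ⟨μ, hμ⟩ := Function.ne_iff.1 hne
    exact ⟨μ, hf.mem_toFinset.2 hμ⟩
  let a := hf.toFinset.min' hnonempty
  let b := hf.toFinset.max' hnonempty
  have hab : a ≤ b := Finset.min'_le_max' _ _
  have ha : f a ≠ 0 := hf.mem_toFinset.1 (Finset.min'_mem _ _)
  refine ha ?_
  rw [← h b (b - a), finsum_eq_single _ a fun μ hμ => ?_]
  · lift b - a to ℕ using sub_nonneg.2 hab with j
    rw [bin_natCast, Ring.choose_natCast, Nat.choose_self, Nat.cast_one, one_smul]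
  · by_cases hfμ : f μ = 0
    · rw [hfμ, smul_zero]
    have haμ : a ≤ μ := Finset.min'_le _ _ (hf.mem_toFinset.2 hfμ)
    have hμb : μ ≤ b := Finset.le_max' _ _ (hf.mem_toFinset.2 hfμ)
    obtain ⟨j, hj⟩ := Int.eq_ofNat_of_zero_le (sub_nonneg.2 hab)
    rw [hj, bin_natCast, choose_eq_zero_of_lt (by omega) (by omega), zero_smul]

theorem IsLaurent₂.eq_of_moment {A B : ℤ → ℤ → M} (hA : IsLaurent₂ A) (hB : IsLaurent₂ B)
    (h : ∀ l p, moment A l p = moment B l p) : A = B := by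
  suffices H : ∀ s, (fun μ => A μ (s - μ) - B μ (s - μ)) = 0 by
    funext m n
    simpa [sub_eq_zero] using congrFun (H (m + n)) m
  intro s
  refine eq_zero_of_finsum_bin_sub ?_ fun r j => ?_
  · simpa [Pi.sub_def] using (hA.hasFiniteSupport 1 s).sub (hB.hasFiniteSupport 1 s)
  · simp only [smul_sub]
    rw [finsum_sub_distrib (hA.hasFiniteSupport _ _) (hB.hasFiniteSupport _ _),
      hA.finsum_bin_sub, hB.finsum_bin_sub]
    simp only [h, sub_self]

end Moment

/-! ### The series `φ(x, z) = x / (1 + zx)` -/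

section Phi

open PowerSeries

/-- The series `(1 + zx)^r` in `ℂ((x))[[z]]`. -/
noncomputable def onePlusPow (r : ℤ) : PowerSeries (LaurentSeries ℂ) :=
  rescale xVar ((binomialSeries ℤ r).map (Int.castRingHom (LaurentSeries ℂ)))

theorem xVar_zpow (n : ℤ) : xVar ^ n = HahnSeries.single n (1 : ℂ) := by
  obtain ⟨k, rfl | rfl⟩ := n.eq_nat_or_neg
  · simp [xVar, HahnSeries.single_pow]
  · simp [xVar, HahnSeries.single_pow, zpow_neg]

theorem xVar_pow (n : ℕ) : xVar ^ n = HahnSeries.single (n : ℤ) (1 : ℂ) := by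
  rw [← zpow_natCast, xVar_zpow]

theorem xVar_ne_zero : xVar ≠ 0 := HahnSeries.single_ne_zero one_ne_zero

theorem coeff_onePlusPow (r : ℤ) (l : ℕ) :
    coeff l (onePlusPow r) = HahnSeries.single (l : ℤ) ((Ring.choose r l : ℤ) : ℂ) := by
  rw [onePlusPow, coeff_rescale, coeff_map, binomialSeries_coeff, smul_eq_mul, mul_one, xVar_pow,
    eq_intCast, ← map_intCast HahnSeries.C, HahnSeries.C_apply, HahnSeries.single_mul_single,
    add_zero, one_mul]

theorem onePlusPow_add (r s : ℤ) : onePlusPow (r + s) = onePlusPow r * onePlusPow s := by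
  simp only [onePlusPow, binomialSeries_add, map_mul]

theorem onePlusPow_zero : onePlusPow 0 = 1 := by
  rw [onePlusPow, binomialSeries_zero, map_one, map_one]

theorem onePlusPow_one : onePlusPow 1 = 1 + X * C xVar := by
  have h := binomialSeries_nat (R := ℤ) (A := ℤ) 1
  rw [Nat.cast_one, pow_one] at h
  rw [onePlusPow, h, map_add, map_one, map_X, map_add, map_one, rescale_X, mul_comm]

theorem onePlusPow_pow (r : ℤ) (n : ℕ) : onePlusPow r ^ n = onePlusPow (n * r) := by
  induction n with
  | zero => rw [pow_zero, Nat.cast_zero, zero_mul, onePlusPow_zero]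
  | succ n ih => rw [pow_succ, ih, ← onePlusPow_add, Nat.cast_succ, add_one_mul]

theorem onePlusPow_neg_mul (r : ℤ) : onePlusPow (-r) * onePlusPow r = 1 := by
  rw [← onePlusPow_add, neg_add_cancel, onePlusPow_zero]

theorem constantCoeff_onePlusPow (r : ℤ) : constantCoeff (onePlusPow r) = 1 := by
  rw [← coeff_zero_eq_constantCoeff_apply, coeff_onePlusPow]
  simp

theorem phi_eq : phi = C xVar * onePlusPow (-1) := by
  rw [phi, ← onePlusPow_one, (PowerSeries.eq_inv_iff_mul_eq_one
    (by rw [constantCoeff_onePlusPow]; exact one_ne_zero)).2 (onePlusPow_neg_mul 1)]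

theorem inv_phi : phi⁻¹ = C xVar⁻¹ * onePlusPow 1 := by
  have hc : constantCoeff phi ≠ 0 := by
    rw [phi_eq, map_mul, constantCoeff_C, constantCoeff_onePlusPow, mul_one]
    exact xVar_ne_zero
  refine ((PowerSeries.eq_inv_iff_mul_eq_one hc).2 ?_).symm
  rw [phi_eq, mul_mul_mul_comm, ← map_mul, inv_mul_cancel₀ xVar_ne_zero, map_one, one_mul,
    mul_comm, onePlusPow_neg_mul]

theorem zpowSeries_phi (m : ℤ) : zpowSeries phi m = C (xVar ^ m) * onePlusPow (-m) := by
  cases m with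
  | ofNat n =>
    rw [zpowSeries, phi_eq, mul_pow, onePlusPow_pow, ← map_pow, Int.ofNat_eq_natCast, mul_neg_one,
      zpow_natCast]
  | negSucc n =>
    rw [zpowSeries, inv_phi, mul_pow, onePlusPow_pow, ← map_pow, Int.negSucc_eq, neg_neg,
      mul_one, inv_pow, zpow_neg, ← Nat.cast_succ, zpow_natCast]

theorem coeff_zpowSeries_phi (m : ℤ) (l : ℕ) :
    coeff l (zpowSeries phi m) = HahnSeries.single (m + l) ((Ring.choose (-m) l : ℤ) : ℂ) := by
  rw [zpowSeries_phi, coeff_C_mul, coeff_onePlusPow, xVar_zpow, HahnSeries.single_mul_single,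
    one_mul]

theorem phi_sub_xVar : phi - C xVar = X * (C (-xVar) * phi) := by
  have h : phi * onePlusPow 1 = C xVar := by
    rw [phi_eq, mul_assoc, onePlusPow_neg_mul, mul_one]
  rw [onePlusPow_one] at h
  rw [map_neg]
  linear_combination h

theorem phi_sub_xVar_pow (k : ℕ) : (phi - C xVar) ^ k
    = X ^ k * (C ((-1) ^ k * xVar ^ (2 * k)) * onePlusPow (-k)) := by
  rw [phi_sub_xVar, phi_eq, ← mul_assoc (C _) (C _), ← map_mul, mul_pow, mul_pow, onePlusPow_pow,
    ← map_pow, mul_neg_one]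
  congr 3
  ring

theorem coeff_phi_sub_xVar_pow_add (k i : ℕ) : coeff (k + i) ((phi - C xVar) ^ k)
    = HahnSeries.single (2 * k + i : ℤ) ((-1 : ℂ) ^ k * ((Ring.choose (-k : ℤ) i : ℤ) : ℂ)) := by
  have hsign : (-1 : LaurentSeries ℂ) ^ k = HahnSeries.single 0 ((-1 : ℂ) ^ k) := by
    rw [← HahnSeries.C_apply, map_pow, map_neg, map_one]
  rw [phi_sub_xVar_pow, add_comm k i, coeff_X_pow_mul, coeff_C_mul, coeff_onePlusPow, xVar_pow,
    mul_assoc, HahnSeries.single_mul_single, one_mul, hsign, HahnSeries.single_mul_single, zero_add,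
    Nat.cast_mul, Nat.cast_ofNat]

theorem coeff_phi_sub_xVar_pow_of_lt {k n : ℕ} (h : n < k) :
    coeff n ((phi - C xVar) ^ k) = 0 := by
  rw [phi_sub_xVar_pow, coeff_X_pow_mul', if_neg (not_le.2 h)]

end Phi

/-! ### Associativity in the variable `y = x⁻¹` -/

section Assoc

variable {V : Type u} [AddCommGroup V] [Module ℂ V] {W : Type v} [AddCommGroup W] [Module ℂ W]

theorem exists_coeff_eq_zero (F : VertexOperator ℂ W) (w : W) :
    ∃ N : ℤ, ∀ n < N, HVertexOperator.coeff F n w = 0 :=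
  ⟨_, fun n hn => VertexOperator.coeff_eq_zero_of_lt_order F n w hn⟩

/-- The coefficient of `x^n` in `Y_W(v, x)w`, as a linear map in `v`. -/
def coeffHom (YW : V →ₗ[ℂ] VertexOperator ℂ W) (n : ℤ) (w : W) : V →ₗ[ℂ] W where
  toFun v := HVertexOperator.coeff (YW v) n w
  map_add' u v := by simp
  map_smul' c v := by simp

theorem coeff_map_zero (YW : V →ₗ[ℂ] VertexOperator ℂ W) (n : ℤ) (w : W) :
    HVertexOperator.coeff (YW 0) n w = 0 :=
  map_zero (coeffHom YW n w)

/-- The coefficients of `Y_W(a, x₁) Y_W(b, x₂) w`. -/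
def prodCoeff (YW : V →ₗ[ℂ] VertexOperator ℂ W) (a b : V) (w : W) : ℤ → ℤ → W := fun m n =>
  HVertexOperator.coeff (YW a) m (HVertexOperator.coeff (YW b) n w)

theorem exists_prodCoeff_eq_zero (YW : V →ₗ[ℂ] VertexOperator ℂ W) (a b : V) (w : W) :
    ∃ N : ℤ, ∀ m n, n < N → prodCoeff YW a b w m n = 0 := by
  obtain ⟨N, hN⟩ := exists_coeff_eq_zero (YW b) w
  exact ⟨N, fun m n hn => by rw [prodCoeff, hN n hn, map_zero]⟩

/-- Associativity of `Y_W` for the pair `(a, b)` and `y₁ = y₂ + z`, where `y = x⁻¹`, after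
multiplication by `(y₁ - y₂)^k = z^k`. -/
structure IsInvAssoc (Y : V →ₗ[ℂ] VertexOperator ℂ V) (YW : V →ₗ[ℂ] VertexOperator ℂ W) (k : ℕ)
    (a b : V) : Prop where
  laurent : ∀ w, IsLaurent₂ (expand k (prodCoeff YW a b w))
  moment_eq : ∀ w l p, moment (expand k (prodCoeff YW a b w)) l p
    = HVertexOperator.coeff (YW (HVertexOperator.coeff (Y a) (l - k) b)) p w

theorem locProd_eq (YW : V →ₗ[ℂ] VertexOperator ℂ W) (k : ℕ) (a b : V) (w : W) (m n : ℤ) :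
    locProd YW k a b w m n = ((-1) ^ k : ℤ) • expand k (prodCoeff YW a b w) (m - k) (n - k) := by
  rw [← expand_natCast_swap, expand_natCast, locProd]
  refine Finset.sum_congr rfl fun i _ => ?_
  rw [← Int.cast_smul_eq_zsmul ℂ, swap, prodCoeff, sub_add, sub_add_cancel]
  push_cast
  rfl

theorem isLaurent₂_locProd_iff (YW : V →ₗ[ℂ] VertexOperator ℂ W) (k : ℕ) (a b : V) (w : W) :
    IsLaurent₂ (locProd YW k a b w) ↔ IsLaurent₂ (expand k (prodCoeff YW a b w)) := by
  constructor
  · rintro ⟨N, hN⟩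
    refine ⟨N - k, fun m n hmn => ?_⟩
    have h := hN (m + k) (n + k) (by omega)
    rwa [locProd_eq, add_sub_cancel_right, add_sub_cancel_right,
      (isUnit_neg_one.pow k).smul_eq_zero] at h
  · rintro ⟨N, hN⟩
    refine ⟨N + k, fun m n hmn => ?_⟩
    rw [locProd_eq, hN _ _ (by omega), smul_zero]

theorem substCoeff_locProd {YW : V →ₗ[ℂ] VertexOperator ℂ W} {k : ℕ} {a b : V} {w : W}
    (h : IsLaurent₂ (expand k (prodCoeff YW a b w))) (l p : ℤ) :
    substCoeff phi (locProd YW k a b w) l p = ((-1) ^ k : ℤ) • ∑ᶠ i : ℕ, Ring.choose (-k : ℤ) i •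
      moment (expand k (prodCoeff YW a b w)) (l - i) (p - 2 * k - i) := by
  have hmoment := h.finsum_bin_sub (-k) l (p - l - 2 * k)
  simp only [show ∀ i : ℕ, p - l - 2 * k + l - i = p - 2 * k - i from fun i => by ring] at hmoment
  rw [← hmoment, substCoeff]
  split_ifs with hl
  · lift l to ℕ using hl
    let e : ℤ → ℤ × ℤ := fun μ => (μ + k, p - l - (μ + k))
    have he : Function.Injective e := fun μ ν h => add_left_injective _ (congrArg Prod.fst h)
    rw [smul_finsum' _ (h.hasFiniteSupport _ _), Int.toNat_natCast, ← finsum_comp_of_injective he]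
    · refine finsum_congr fun μ => ?_
      simp only [e]
      rw [coeff_zpowSeries_phi, show p - (p - l - (μ + k)) = μ + k + l by ring,
        HahnSeries.coeff_single_same, locProd_eq, Int.cast_smul_eq_zsmul, smul_comm, bin_natCast]
      congr 3 <;> ring_nf
    · rintro ⟨m, n⟩ hmn
      refine ⟨m - k, by_contra fun hc => hmn ?_⟩
      dsimp only
      rw [coeff_zpowSeries_phi, HahnSeries.coeff_single_of_ne, zero_smul]
      refine fun heq => hc (Prod.ext (sub_add_cancel m _) ?_)
      simp only [e]
      omega
  · rw [finsum_eq_zero_of_forall_eq_zero fun μ => by rw [bin_of_neg _ (by omega), zero_smul],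
      smul_zero]

theorem iterCoeff_phi_sub_xVar_pow (Y : V →ₗ[ℂ] VertexOperator ℂ V)
    (YW : V →ₗ[ℂ] VertexOperator ℂ W) (k : ℕ) (a b : V) (w : W) (l p : ℤ) :
    iterCoeff Y YW ((phi - PowerSeries.C xVar) ^ k) a b w l p
      = ((-1) ^ k : ℤ) • ∑ᶠ i : ℕ, Ring.choose (-k : ℤ) i • HVertexOperator.coeff
          (YW (HVertexOperator.coeff (Y a) (l - i - k) b)) (p - 2 * k - i) w := by
  obtain ⟨N, hN⟩ := exists_coeff_eq_zero (Y a) b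
  let e : ℕ → ℕ × ℤ := fun i => (k + i, 2 * k + i)
  have he : Function.Injective e := fun i j h => add_right_injective k (congrArg Prod.fst h)
  rw [smul_finsum' _ (hasFiniteSupport_of_le (N := (l - k - N + 1).toNat) fun i hi => by
    rw [hN _ (by omega), coeff_map_zero, smul_zero]),
    iterCoeff, ← finsum_comp_of_injective he]
  · refine finsum_congr fun i => ?_
    simp only [e]
    rw [coeff_phi_sub_xVar_pow_add, HahnSeries.coeff_single_same, mul_smul, Int.cast_smul_eq_zsmul,
      show l - ((k + i : ℕ) : ℤ) = l - i - k by push_cast; ring,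
      show p - (2 * k + i : ℤ) = p - 2 * k - i by ring, ← Int.cast_smul_eq_zsmul ℂ ((-1) ^ k)]
    push_cast
    rfl
  · rintro ⟨n, q⟩ hnq
    by_contra hc
    refine hnq ?_
    dsimp only
    rcases lt_or_ge n k with h | h
    · rw [coeff_phi_sub_xVar_pow_of_lt h, HahnSeries.coeff_zero, zero_smul]
    · obtain ⟨i, rfl⟩ := Nat.exists_eq_add_of_le h
      rw [coeff_phi_sub_xVar_pow_add, HahnSeries.coeff_single_of_ne, zero_smul]
      rintro rfl
      exact hc ⟨i, rfl⟩

theorem eq_of_finsum_smul_sub_eq {M : Type*} [AddCommGroup M] {F G : ℤ → ℤ → M} {N : ℤ}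
    (hF : ∀ l p, l < N → F l p = 0) (hG : ∀ l p, l < N → G l p = 0) {c : ℕ → ℤ} (hc : c 0 = 1)
    (h : ∀ l p, ∑ᶠ i : ℕ, c i • F (l - i) (p - i) = ∑ᶠ i : ℕ, c i • G (l - i) (p - i)) :
    F = G := by
  have hfin : ∀ H : ℤ → ℤ → M, (∀ l p, l < N → H l p = 0) → ∀ l p,
      (fun i : ℕ => c i • H (l - i) (p - i)).HasFiniteSupport := fun H hH l p =>
    hasFiniteSupport_of_le (N := (l - N + 1).toNat) fun i hi => by
      rw [hH _ _ (by omega), smul_zero]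
  have hlt : ∀ d : ℕ, ∀ l < N + d, ∀ p, F l p = G l p := by
    intro d
    induction d with
    | zero => intro l hl p; rw [hF _ _ (by simpa using hl), hG _ _ (by simpa using hl)]
    | succ d ih =>
      intro l hl p
      have hdiff := sub_eq_zero.2 (h l p)
      rw [← finsum_sub_distrib (hfin F hF l p) (hfin G hG l p),
        finsum_eq_single _ 0 fun i hi => by
          rw [ih _ (by push_cast at hl; omega), sub_self]] at hdiff
      simpa [hc, sub_eq_zero] using hdiff
  exact funext₂ fun l p => hlt ((l - N).toNat + 1) l (by push_cast; omega) p

theorem isPhiModule_iff (A : VertexAlgebra V) (YW : V →ₗ[ℂ] VertexOperator ℂ W) :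
    IsPhiModule phi A YW ↔ IsVacuum A.one YW ∧ ∀ a b, ∃ k, IsInvAssoc A.Y YW k a b := by
  refine ⟨fun h => ⟨h.vacuum, fun a b => ?_⟩, fun h => ⟨h.1, fun a b => ?_⟩⟩
  · obtain ⟨k, hlaurent, hassoc⟩ := h.assoc a b
    have hlaurent' := fun w => (isLaurent₂_locProd_iff YW k a b w).1 (hlaurent w)
    obtain ⟨N, hN⟩ := exists_coeff_eq_zero (A.Y a) b
    refine ⟨k, hlaurent', fun w => congrFun₂ (eq_of_finsum_smul_sub_eq (N := min 0 (N + k))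
      (F := moment (expand k (prodCoeff YW a b w)))
      (G := fun l p => HVertexOperator.coeff (YW (HVertexOperator.coeff (A.Y a) (l - k) b)) p w)
      (c := fun i => Ring.choose (-k : ℤ) i)
      (fun l p hl => moment_of_neg _ (by omega) _) (fun l p hl => ?_)
      (Ring.choose_zero_right _) fun l p => ?_)⟩
    · rw [hN _ (by omega), coeff_map_zero]
    · have hcoeff := hassoc w l (p + 2 * k)
      rw [substCoeff_locProd (hlaurent' w), iterCoeff_phi_sub_xVar_pow,
        (isUnit_neg_one.pow k).smul_left_cancel, add_sub_cancel_right] at hcoeff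
      exact hcoeff
  · obtain ⟨k, h⟩ := h.2 a b
    refine ⟨k, fun w => (isLaurent₂_locProd_iff YW k a b w).2 (h.laurent w), fun w l p => ?_⟩
    rw [substCoeff_locProd (h.laurent w), iterCoeff_phi_sub_xVar_pow]
    simp only [h.moment_eq]

end Assoc

/-! ### The Jacobi identity in the variable `y = x⁻¹` -/

section Jacobi

variable {V : Type u} [AddCommGroup V] [Module ℂ V] {W : Type v} [AddCommGroup W] [Module ℂ W]
  {Y : V →ₗ[ℂ] VertexOperator ℂ V} {YW : V →ₗ[ℂ] VertexOperator ℂ W} {k : ℕ} {a b : V}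

/-- The Jacobi identity for `Y_W(·, y⁻¹)` and the pair `(a, b)`, with the order of the operators
reversed: `Y_W(b, x₂) Y_W(a, x₁)` is paired with the expansion of `(y₁ - y₂)^l` in nonnegative
powers of `y₂`. -/
def InvJacobi (Y : V →ₗ[ℂ] VertexOperator ℂ V) (YW : V →ₗ[ℂ] VertexOperator ℂ W) (a b : V) : Prop :=
  ∀ (w : W) (l m n : ℤ), expand l (swap (prodCoeff YW b a w)) m n
      - (l.negOnePow : ℤ) • expand l (swap (prodCoeff YW a b w)) n m
    = ∑ᶠ i : ℕ, Ring.choose (m - 1) i •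
      HVertexOperator.coeff (YW (VertexOperator.ncoeff (Y a) (l + i) b)) (m + n - 1 - i) w

/-- `(y₁ - y₂)^k [Y_W(a, x₁), Y_W(b, x₂)] = 0`, where `y = x⁻¹`. -/
def IsLocal (YW : V →ₗ[ℂ] VertexOperator ℂ W) (k : ℕ) (a b : V) : Prop :=
  ∀ w, expand k (prodCoeff YW a b w) = expand k (swap (prodCoeff YW b a w))

theorem exists_prodCoeff_eq_zero_and_swap (YW : V →ₗ[ℂ] VertexOperator ℂ W) (a b : V) (w : W) :
    ∃ N, (∀ m n, n < N → prodCoeff YW a b w m n = 0)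
      ∧ ∀ m n, m < N → swap (prodCoeff YW b a w) m n = 0 := by
  obtain ⟨N₁, h₁⟩ := exists_prodCoeff_eq_zero YW a b w
  obtain ⟨N₂, h₂⟩ := exists_prodCoeff_eq_zero YW b a w
  exact ⟨min N₁ N₂, fun m n hn => h₁ m n (by omega), fun m n hm => h₂ n m (by omega)⟩

theorem IsLocal.laurent (h : IsLocal YW k a b) (w : W) :
    IsLaurent₂ (expand k (prodCoeff YW a b w)) := by
  obtain ⟨N, hab, hba⟩ := exists_prodCoeff_eq_zero_and_swap YW a b w
  exact isLaurent₂_of_expand_eq hab hba (h w)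

theorem IsLocal.expand_sub_expand_swap (h : IsLocal YW k a b) (w : W) (l m n : ℤ) :
    expand l (swap (prodCoeff YW b a w)) m n
      - (l.negOnePow : ℤ) • expand l (swap (prodCoeff YW a b w)) n m
    = ∑ᶠ i : ℕ, Ring.choose (m - 1) i •
      moment (expand k (prodCoeff YW a b w)) (k - 1 - l - i) (m + n - 1 - i) := by
  obtain ⟨N, hab, hba⟩ := exists_prodCoeff_eq_zero_and_swap YW a b w
  rw [VertexOp.expand_sub_expand_swap hab hba (h w), (h.laurent w).finsum_bin_sub]
  simp only [sub_add_cancel]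

theorem finsum_choose_one_sub_one {M : Type*} [AddCommGroup M] (f : ℕ → M) :
    ∑ᶠ i : ℕ, Ring.choose (1 - 1 : ℤ) i • f i = f 0 := by
  rw [sub_self, finsum_eq_single _ 0 fun i hi => by
    rw [Ring.choose_zero_pos _ (Nat.pos_of_ne_zero hi), zero_smul], Ring.choose_zero_right,
    one_smul]

theorem IsLocal.isInvAssoc_iff (Y : V →ₗ[ℂ] VertexOperator ℂ V) (h : IsLocal YW k a b) :
    IsInvAssoc Y YW k a b ↔ InvJacobi Y YW a b := by
  constructor
  · intro hassoc w l m n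
    rw [h.expand_sub_expand_swap]
    refine finsum_congr fun i => ?_
    rw [hassoc.moment_eq, VertexOperator.ncoeff_apply,
      show (k - 1 - l - i - k : ℤ) = -(l + i) - 1 by ring]
  · refine fun hjacobi => ⟨h.laurent, fun w l p => ?_⟩
    have hcoeff := hjacobi w (k - 1 - l) 1 p
    rw [h.expand_sub_expand_swap, finsum_choose_one_sub_one, finsum_choose_one_sub_one] at hcoeff
    simpa only [Nat.cast_zero, sub_zero, add_zero, sub_sub_cancel, add_sub_cancel_left,
      VertexOperator.ncoeff_apply, show -(k - 1 - l : ℤ) - 1 = l - k by ring] using hcoeff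

theorem InvJacobi.exists_isLocal (h : InvJacobi Y YW a b) : ∃ k, IsLocal YW k a b := by
  obtain ⟨N, hN⟩ := exists_coeff_eq_zero (Y a) b
  refine ⟨(-N).toNat, fun w => funext₂ fun m n => ?_⟩
  have hcoeff := h w ((-N).toNat : ℤ) m n
  rw [finsum_eq_zero_of_forall_eq_zero fun i => by
      rw [VertexOperator.ncoeff_apply, hN _ (by omega), coeff_map_zero, smul_zero],
    expand_natCast_swap _ (prodCoeff YW a b w), smul_smul, Int.coe_negOnePow_natCast, ← pow_add,
    Even.neg_one_pow ⟨_, rfl⟩, one_smul, sub_eq_zero] at hcoeff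
  exact hcoeff.symm

theorem isInvAssoc_succ_iff (h : ∀ w, IsLaurent₂ (expand k (prodCoeff YW a b w))) :
    IsInvAssoc Y YW (k + 1) a b ↔ IsInvAssoc Y YW k a b := by
  have hsub : ∀ l : ℤ, l - (k + 1 : ℕ) = l - 1 - k := fun l => by push_cast; ring
  constructor
  · refine fun hassoc => ⟨h, fun w l p => ?_⟩
    have hmoment := hassoc.moment_eq w (l + 1) p
    rwa [(h w).moment_expand_succ, hsub, add_sub_cancel_right] at hmoment
  · refine fun hassoc => ⟨fun w => (h w).expand_succ, fun w l p => ?_⟩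
    rw [(h w).moment_expand_succ, hassoc.moment_eq, hsub]

theorem IsInvAssoc.mono {k' : ℕ} (h : IsInvAssoc Y YW k a b) (hk : k ≤ k') :
    IsInvAssoc Y YW k' a b := by
  induction k', hk using Nat.le_induction with
  | base => exact h
  | succ n _ ih => exact (isInvAssoc_succ_iff ih.laurent).2 ih

theorem IsInvAssoc.of_isLaurent₂ (h : IsInvAssoc Y YW k a b)
    (h0 : ∀ w, IsLaurent₂ (expand 0 (prodCoeff YW a b w))) : IsInvAssoc Y YW 0 a b := by
  have hlaurent : ∀ n : ℕ, ∀ w, IsLaurent₂ (expand n (prodCoeff YW a b w)) := by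
    intro n
    induction n with
    | zero => exact h0
    | succ n ih => exact fun w => (ih w).expand_succ
  induction k with
  | zero => exact h
  | succ n ih => exact ih ((isInvAssoc_succ_iff (hlaurent n)).1 h)

/-- `Y_W(e^{zD} a, x) = Y_W(a, φ(x, z))`, where `e^{zD} a = Y(a, z)1`. -/
theorem coeff_translate (A : VertexAlgebra V) (hvac : IsVacuum A.one YW)
    (h : IsInvAssoc A.Y YW k a A.one) (w : W) (l : ℕ) (p : ℤ) :
    HVertexOperator.coeff (YW (HVertexOperator.coeff (A.Y a) l A.one)) p w
      = Ring.choose (l - p) l • HVertexOperator.coeff (YW a) (p - l) w := by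
  have hprod : ∀ w m n, expand 0 (prodCoeff YW a A.one w) m n
      = if n = 0 then HVertexOperator.coeff (YW a) m w else 0 := by
    intro w m n
    rw [expand_zero, prodCoeff, hvac]
    split_ifs <;> simp
  have hassoc : IsInvAssoc A.Y YW 0 a A.one := by
    refine h.of_isLaurent₂ fun w => ?_
    obtain ⟨N, hN⟩ := exists_coeff_eq_zero (YW a) w
    refine ⟨min N 0, fun m n hmn => ?_⟩
    rw [hprod]
    split_ifs with hn
    · exact hN _ (by omega)
    · rfl
  have hmoment := hassoc.moment_eq w l p
  rw [Nat.cast_zero, sub_zero] at hmoment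
  rw [← hmoment, moment, finsum_eq_single _ (p - l) fun μ hμ => by
    rw [hprod, if_neg (by omega), smul_zero], hprod, if_pos (by ring), bin_natCast, neg_sub]

/-- Skew symmetry: `Y(a, x)b = e^{xD} Y(b, -x)a`. -/
theorem VertexAlgebra.skew (A : VertexAlgebra V) (a b : V) (l : ℤ) :
    VertexOperator.ncoeff (A.Y a) l b = -(l.negOnePow : ℤ) • ∑ᶠ i : ℕ, ((-1) ^ i : ℤ) •
      HVertexOperator.coeff (A.Y (VertexOperator.ncoeff (A.Y b) (l + i) a)) i A.one := by
  have hregular : ∀ (c : V) (n : ℤ), 0 ≤ n → VertexOperator.ncoeff (A.Y c) n A.one = 0 :=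
    fun c n hn => A.creation_regular c _ (by omega)
  have hlimit : VertexOperator.ncoeff (A.Y b) (-1) A.one = b := A.creation_limit b
  have hterm : ∀ i : ℕ, ((Ring.choose (-1 : ℤ) i : ℤ) : ℂ) •
      VertexOperator.ncoeff (A.Y (VertexOperator.ncoeff (A.Y b) (l + i) a)) (-1 + 0 - i) A.one
      = ((-1) ^ i : ℤ) •
        HVertexOperator.coeff (A.Y (VertexOperator.ncoeff (A.Y b) (l + i) a)) i A.one := by
    intro i
    rw [Int.cast_smul_eq_zsmul, choose_neg_eq, VertexOperator.ncoeff_apply,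
      show (1 : ℤ) + i - 1 = (i : ℕ) by ring, Ring.choose_natCast, Nat.choose_self, Nat.cast_one,
      mul_one, show -(-1 + 0 - (i : ℤ)) - 1 = i by ring]
  have h := A.jacobi b a A.one l (-1) 0
  rw [finsum_congr hterm,
    finsum_eq_zero_of_forall_eq_zero fun i => by rw [hregular _ _ (by omega), map_zero, smul_zero],
    finsum_eq_single _ 0 fun i hi => by rw [hregular _ _ (by omega), map_zero, smul_zero],
    zero_sub, Nat.cast_zero, add_zero, hlimit, zero_add, sub_zero, pow_zero, mul_one,
    Ring.choose_zero_right, Int.cast_one, mul_one, ← Int.cast_negOnePow, Int.cast_smul_eq_zsmul]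
    at h
  rw [← h, neg_smul, smul_neg, neg_neg, smul_smul, ← Units.val_mul, ← Int.negOnePow_add,
    Int.negOnePow_even _ ⟨l, rfl⟩, Units.val_one, one_smul]

theorem moment_expand_prodCoeff_comm (A : VertexAlgebra V) (hvac : IsVacuum A.one YW)
    (h : ∀ c, ∃ k, IsInvAssoc A.Y YW k c A.one) (hab : IsInvAssoc A.Y YW k a b)
    (hba : IsInvAssoc A.Y YW k b a) (w : W) (l p : ℤ) :
    moment (expand k (prodCoeff YW a b w)) l p
      = -((k - l - 1 : ℤ).negOnePow : ℤ) • ∑ᶠ i : ℕ, Ring.choose (p - 1) i •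
        moment (expand k (prodCoeff YW b a w)) (l - i) (p - i) := by
  obtain ⟨N, hN⟩ := exists_coeff_eq_zero (A.Y b) a
  rw [hab.moment_eq, show (l - k : ℤ) = -(k - l - 1) - 1 by ring, ← VertexOperator.ncoeff_apply,
    A.skew]
  change coeffHom YW p w _ = _
  rw [map_zsmul, map_finsum (coeffHom YW p w) (hasFiniteSupport_of_le
    (N := (-N - (k - l - 1)).toNat) fun i hi => by
      rw [VertexOperator.ncoeff_apply, hN _ (by omega), coeff_map_zero, smul_zero])]
  congr 1
  refine finsum_congr fun i => ?_
  obtain ⟨k', hk'⟩ := h (VertexOperator.ncoeff (A.Y b) (k - l - 1 + i) a)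
  rw [map_zsmul]
  change _ • HVertexOperator.coeff (YW (HVertexOperator.coeff (A.Y _) i A.one)) p w = _
  rw [coeff_translate A hvac hk', smul_smul, hba.moment_eq, choose_eq_choose_sub (p - 1),
    show (i : ℤ) - 1 - (p - 1) = i - p by ring, VertexOperator.ncoeff_apply,
    show -(k - l - 1 + i : ℤ) - 1 = l - i - k by ring]

theorem neg_negOnePow_sub_sub_one (k l : ℕ) :
    -((k - l - 1 : ℤ).negOnePow : ℤ) = (-1) ^ k * (-1) ^ l := by
  rw [Int.negOnePow_sub, Int.negOnePow_sub, Int.negOnePow_one]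
  simp [Int.coe_negOnePow_natCast]

theorem IsInvAssoc.isLocal (A : VertexAlgebra V) (hvac : IsVacuum A.one YW)
    (h : ∀ c, ∃ k, IsInvAssoc A.Y YW k c A.one) (hab : IsInvAssoc A.Y YW k a b)
    (hba : IsInvAssoc A.Y YW k b a) : IsLocal YW k a b := by
  intro w
  have hswap : expand k (swap (prodCoeff YW b a w))
      = ((-1) ^ k : ℤ) • swap (expand k (prodCoeff YW b a w)) :=
    funext₂ fun m n => expand_natCast_swap k _ n m
  rw [hswap]
  refine (hab.laurent w).eq_of_moment ((hba.laurent w).swap.zsmul _) fun l p => ?_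
  rcases lt_or_ge l 0 with hl | hl
  · rw [moment_of_neg _ hl, moment_of_neg _ hl]
  lift l to ℕ using hl
  rw [moment_expand_prodCoeff_comm A hvac h hab hba, (hba.laurent w).swap.moment_zsmul,
    (hba.laurent w).moment_swap, neg_negOnePow_sub_sub_one, mul_smul]

theorem exists_isInvAssoc_iff (A : VertexAlgebra V) (hvac : IsVacuum A.one YW) :
    (∀ a b, ∃ k, IsInvAssoc A.Y YW k a b) ↔ ∀ a b, InvJacobi A.Y YW a b := by
  refine ⟨fun h a b => ?_, fun h a b => ?_⟩
  · obtain ⟨k₁, h₁⟩ := h a b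
    obtain ⟨k₂, h₂⟩ := h b a
    have hab := h₁.mono (le_max_left k₁ k₂)
    have hlocal := hab.isLocal A hvac (fun c => h c A.one) (h₂.mono (le_max_right k₁ k₂))
    exact (hlocal.isInvAssoc_iff A.Y).1 hab
  · obtain ⟨k, hk⟩ := (h a b).exists_isLocal
    exact ⟨k, (hk.isInvAssoc_iff A.Y).2 (h a b)⟩

end Jacobi

/-! ### Divided powers of `L(1)` -/

theorem map_tripleSum_choose {M : Type*} [AddCommGroup M] (T : M →+ M) (q : ℤ)
    (X : ℕ → ℕ → ℕ → M) (hT : ∀ i j s : ℕ, T (X i j s) = ((i + 1 : ℕ) : ℤ) • X (i + 1) j s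
      + (q - 2 * i - s - 2) • X i j (s + 1) + ((j + 1 : ℕ) : ℤ) • X i (j + 1) s) (N : ℕ) :
    T (tripleSum N fun i j s => Ring.choose (q - i - 2) s • X i j s)
      = (N + 1 : ℤ) • tripleSum (N + 1) fun i j s => Ring.choose (q - i - 2) s • X i j s := by
  let f₁ : ℕ → ℕ → ℕ → M := fun i j s => (i * bin (q - i - 1) s) • X i j s
  let f₂ : ℕ → ℕ → ℕ → M := fun i j s => (j * bin (q - i - 2) s) • X i j s
  let f₃ : ℕ → ℕ → ℕ → M := fun i j s => ((q - 2 * i - s - 1) * bin (q - i - 2) (s - 1)) • X i j s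
  calc T (tripleSum N fun i j s => Ring.choose (q - i - 2) s • X i j s)
    _ = tripleSum N fun i j s => f₁ (i + 1) j s + f₂ i (j + 1) s + f₃ i j (s + 1) := by
        rw [map_tripleSum]
        refine tripleSum_congr fun i j s _ => ?_
        simp only [f₁, f₂, f₃, map_zsmul, hT, smul_add, smul_smul, bin_natCast, Nat.cast_succ,
          add_sub_cancel_right, show q - (i + 1 : ℤ) - 1 = q - i - 2 by ring,
          show q - 2 * i - (s + 1 : ℤ) - 1 = q - 2 * i - s - 2 by ring]
        module
    _ = tripleSum (N + 1) fun i j s => f₁ i j s + f₂ i j s + f₃ i j s := by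
        simp only [tripleSum_add]
        rw [tripleSum_succ_fst N fun j s => by simp [f₁],
          tripleSum_succ_snd N fun i s => by simp [f₂],
          tripleSum_succ_trd N fun i j => by simp [f₃, bin]]
    _ = _ := by
        rw [← zsmulAddGroupHom_apply, map_tripleSum]
        refine tripleSum_congr fun i j s h => ?_
        have hN : (N + 1 : ℤ) = i + j + s := by exact_mod_cast h.symm
        have hpascal := bin_succ (q - i - 2) s
        rw [show q - (i : ℤ) - 2 + 1 = q - i - 1 by ring] at hpascal
        simp only [f₁, f₂, f₃, zsmulAddGroupHom_apply, smul_smul, ← add_smul, ← bin_natCast, hN,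
          hpascal]
        congr 1
        linear_combination -mul_bin (q - i - 2) s

namespace VertexOperatorAlgebra

variable {V : Type u} [AddCommGroup V] [Module ℂ V] (A : VertexOperatorAlgebra V) {p q : ℤ}
  {a b : V}

theorem commutator (a b c : V) (m n : ℤ) :
    VertexOperator.ncoeff (A.Y a) m (VertexOperator.ncoeff (A.Y b) n c)
      - VertexOperator.ncoeff (A.Y b) n (VertexOperator.ncoeff (A.Y a) m c)
    = ∑ᶠ i : ℕ, Ring.choose m i •
      VertexOperator.ncoeff (A.Y (VertexOperator.ncoeff (A.Y a) i b)) (m + n - i) c := by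
  have h := A.jacobi a b c 0 m n
  rw [finsum_eq_single _ 0 fun i hi => by
      rw [Ring.choose_zero_pos _ (Nat.pos_of_ne_zero hi), Int.cast_zero, mul_zero, zero_smul],
    finsum_eq_single _ 0 fun i hi => by
      rw [Ring.choose_zero_pos _ (Nat.pos_of_ne_zero hi), Int.cast_zero, mul_zero, zero_smul]] at h
  simpa [Int.cast_smul_eq_zsmul] using h

theorem ncoeff_L_neg_one (a c : V) (n : ℤ) :
    VertexOperator.ncoeff (A.Y (VertexOperator.ncoeff (A.Y A.ω) 0 a)) n c
      = -n • VertexOperator.ncoeff (A.Y a) (n - 1) c := by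
  rw [VertexOperator.ncoeff_apply, A.L_neg_one, LinearMap.smul_apply, ← Int.cast_smul_eq_zsmul ℂ,
    VertexOperator.ncoeff_apply, show -(n - 1) - 1 = -n - 1 + 1 by ring]
  congr 1
  push_cast
  ring

theorem L_zero_ncoeff (ha : a ∈ A.gr p) (b : V) (n : ℤ) :
    A.L 0 (VertexOperator.ncoeff (A.Y a) n b)
      = VertexOperator.ncoeff (A.Y a) n (A.L 0 b)
        + (p - n - 1) • VertexOperator.ncoeff (A.Y a) n b := by
  have h := A.commutator A.ω a b 1 n
  rw [finsum_eq_sum_range (N := 2) fun i hi => by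
    rw [choose_eq_zero_of_lt (by norm_num) (by omega), zero_smul], Finset.sum_range_succ,
    Finset.sum_range_one] at h
  simp only [Ring.choose_zero_right, Ring.choose_one_right, one_smul, Nat.cast_zero, Nat.cast_one,
    ncoeff_L_neg_one, A.L_zero p a ha, Int.cast_smul_eq_zsmul, map_zsmul,
    Pi.smul_apply, LinearMap.smul_apply, sub_zero] at h
  rw [L, zero_add, sub_eq_iff_eq_add'.1 h, add_sub_cancel_left]
  module

theorem ncoeff_mem_gr (ha : a ∈ A.gr p) (hb : b ∈ A.gr q) (n : ℤ) :
    VertexOperator.ncoeff (A.Y a) n b ∈ A.gr (p + q - n - 1) := by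
  have hL : A.L 0 b = (q : ℂ) • b := A.L_zero q b hb
  apply A.mem_gr_of_L_zero
  rw [A.L_zero_ncoeff ha, hL, map_smul, Int.cast_smul_eq_zsmul, Int.cast_smul_eq_zsmul, ← add_smul]
  congr 1
  ring

theorem L_one_ncoeff (ha : a ∈ A.gr p) (b : V) (n : ℤ) :
    A.L 1 (VertexOperator.ncoeff (A.Y a) n b)
      = VertexOperator.ncoeff (A.Y (A.L 1 a)) n b
        + (2 * p - n - 2) • VertexOperator.ncoeff (A.Y a) (n + 1) b
        + VertexOperator.ncoeff (A.Y a) n (A.L 1 b) := by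
  have h := A.commutator A.ω a b 2 n
  rw [finsum_eq_sum_range (N := 3) fun i hi => by
    rw [choose_eq_zero_of_lt (by norm_num) (by omega), zero_smul], Finset.sum_range_succ,
    Finset.sum_range_succ, Finset.sum_range_one] at h
  have hchoose : Ring.choose (2 : ℤ) 2 = 1 := by
    rw [show (2 : ℤ) = (2 : ℕ) from rfl, Ring.choose_natCast, Nat.choose_self, Nat.cast_one]
  simp only [Ring.choose_zero_right, Ring.choose_one_right, one_smul, Nat.cast_zero, Nat.cast_one,
    ncoeff_L_neg_one, A.L_zero p a ha, Int.cast_smul_eq_zsmul, map_zsmul,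
    Pi.smul_apply, LinearMap.smul_apply, sub_zero, hchoose, Nat.cast_ofNat] at h
  rw [L, show (1 : ℤ) + 1 = 2 from rfl, sub_eq_iff_eq_add'.1 h, add_sub_cancel_left,
    show 2 + n - 1 = n + 1 by ring]
  module

/-- The divided power `L(1)^j / j!`, that is, the coefficient of `x^j` in `e^{xL(1)}`. -/
noncomputable def dpow (j : ℕ) : Module.End ℂ V := (j.factorial : ℂ)⁻¹ • A.L 1 ^ j

theorem dpow_zero (a : V) : A.dpow 0 a = a := by simp [dpow]

theorem L_one_dpow (j : ℕ) (a : V) :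
    A.L 1 (A.dpow j a) = ((j + 1 : ℕ) : ℤ) • A.dpow (j + 1) a := by
  rw [dpow, dpow, LinearMap.smul_apply, LinearMap.smul_apply, map_smul, pow_succ',
    Module.End.mul_apply, ← Int.cast_smul_eq_zsmul ℂ, smul_smul, Nat.factorial_succ]
  congr 1
  have : (j : ℂ) + 1 ≠ 0 := by exact_mod_cast Nat.succ_ne_zero j
  push_cast
  field_simp

theorem dpow_mem_gr (ha : a ∈ A.gr p) (j : ℕ) : A.dpow j a ∈ A.gr (p - j) := by
  rw [dpow, LinearMap.smul_apply]
  refine Submodule.smul_mem _ _ ?_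
  induction j with
  | zero => simpa using ha
  | succ j ih =>
    rw [pow_succ', Module.End.mul_apply, Nat.cast_succ, ← sub_sub]
    exact A.L_one_mem ih

theorem exists_dpow_eq_zero (a : V) : ∃ N : ℕ, ∀ j, N ≤ j → A.dpow j a = 0 := by
  obtain ⟨N, hN⟩ := A.L_one_locally_nilpotent a
  exact ⟨N, fun j hj => by rw [dpow, LinearMap.smul_apply, hN j hj, smul_zero]⟩

theorem dpow_dpow (i j : ℕ) (a : V) :
    A.dpow i (A.dpow j a) = ((i + j).choose i : ℤ) • A.dpow (i + j) a := by
  rw [dpow, dpow, dpow, LinearMap.smul_apply, LinearMap.smul_apply, LinearMap.smul_apply, map_smul,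
    ← Module.End.mul_apply, ← pow_add, smul_smul, ← Int.cast_smul_eq_zsmul ℂ, smul_smul]
  congr 1
  rw [Int.cast_natCast, Nat.choose_symm_add, Nat.add_choose, Nat.cast_div
    (Nat.factorial_mul_factorial_dvd_factorial_add i j) (by simp [Nat.factorial_ne_zero])]
  have : ((i + j).factorial : ℂ) ≠ 0 := by exact_mod_cast (i + j).factorial_ne_zero
  push_cast
  field_simp

/-- The component form of
`e^{tL(1)} Y(a, z) e^{-tL(1)} = Y(e^{t(1-tz)L(1)} (1-tz)^{-2L(0)} a, z/(1-tz))`. -/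
theorem dpow_ncoeff (ha : a ∈ A.gr p) (b : V) (n : ℤ) (N : ℕ) :
    A.dpow N (VertexOperator.ncoeff (A.Y a) n b)
      = tripleSum N fun i j s => Ring.choose (2 * p - n - i - 2) s •
        VertexOperator.ncoeff (A.Y (A.dpow i a)) (n + s) (A.dpow j b) := by
  induction N with
  | zero => simp [tripleSum, dpow_zero]
  | succ N ih =>
    have h := map_tripleSum_choose (A.L 1).toAddMonoidHom (2 * p - n) (fun i j s =>
      VertexOperator.ncoeff (A.Y (A.dpow i a)) (n + s) (A.dpow j b)) (fun i j s => by
        change A.L 1 _ = _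
        rw [A.L_one_ncoeff (A.dpow_mem_gr ha i), A.L_one_dpow, A.L_one_dpow, map_zsmul, map_zsmul,
          map_zsmul, Pi.smul_apply, LinearMap.smul_apply, add_assoc n, Nat.cast_succ,
          show 2 * (p - (i : ℤ)) - (n + s) - 2 = 2 * p - n - 2 * i - s - 2 by ring]
        rfl) N
    rw [← ih] at h
    change A.L 1 _ = _ at h
    rw [L_one_dpow, Nat.cast_succ] at h
    rw [← Int.cast_smul_eq_zsmul ℂ, ← Int.cast_smul_eq_zsmul ℂ] at h
    exact smul_right_injective V (by exact_mod_cast N.succ_ne_zero) h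

theorem one_mem_gr : A.one ∈ A.gr 0 := by
  apply A.mem_gr_of_L_zero
  rw [Int.cast_zero, zero_smul]
  exact A.creation_regular _ _ (by norm_num)

theorem dpow_one {j : ℕ} (hj : j ≠ 0) : A.dpow j A.one = 0 := by
  obtain ⟨i, rfl⟩ := Nat.exists_eq_succ_of_ne_zero hj
  have hL : A.L 1 A.one = 0 := A.creation_regular _ _ (by norm_num)
  rw [dpow, LinearMap.smul_apply, pow_succ, Module.End.mul_apply, hL, map_zero, smul_zero]

theorem gr_induction {P : V → Prop} (hzero : P 0) (hadd : ∀ a b, P a → P b → P (a + b))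
    (hgr : ∀ p, ∀ a ∈ A.gr p, P a) (a : V) : P a := by
  classical
  rw [← A.decomp.symm_apply_apply a]
  induction A.decomp a using DirectSum.induction_on with
  | zero => rwa [map_zero]
  | add x y hx hy => rw [map_add]; exact hadd _ _ hx hy
  | of m x => rw [A.decomp_symm_of]; exact hgr m _ x.2

/-! ### The transformed vertex operator map -/

variable {W : Type v} [AddCommGroup W] [Module ℂ W]

theorem decomp_of_mem (ha : a ∈ A.gr p) :
    A.decomp a = DirectSum.lof ℂ ℤ (fun n => A.gr n) p ⟨a, ha⟩ := by
  rw [← LinearEquiv.eq_symm_apply]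
  exact (A.decomp_symm_of p ⟨a, ha⟩).symm

theorem negInvSqPowL0_of_mem (ha : a ∈ A.gr p) :
    A.negInvSqPowL0 a = (p.negOnePow : ℤ) • Finsupp.single (-2 * p) a := by
  rw [negInvSqPowL0, LinearMap.comp_apply, LinearEquiv.coe_coe, A.decomp_of_mem ha,
    DirectSum.toModule_lof, ← Int.cast_smul_eq_zsmul ℂ, Int.cast_negOnePow]
  rfl

theorem lsum_Phi (ha : a ∈ A.gr p) (f : ℤ → V →ₗ[ℂ] W) :
    Finsupp.lsum ℂ f (A.Phi a) = (p.negOnePow : ℤ) • ∑ᶠ j : ℕ, f (j - 2 * p) (A.dpow j a) := by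
  rw [Phi, LinearMap.comp_apply, A.negInvSqPowL0_of_mem ha, map_zsmul, map_zsmul,
    Finsupp.lsum_single, LinearMap.comp_apply]
  congr 1
  change (Finsupp.lsum ℂ f ∘ₗ Finsupp.lmapDomain V ℂ _).toAddMonoidHom
    (∑ᶠ j : ℕ, Finsupp.single (j : ℤ) (A.dpow j a)) = _
  rw [AddMonoidHom.map_finsum (f := fun j : ℕ => Finsupp.single (j : ℤ) (A.dpow j a)) _
    (A.expL1_finite a)]
  refine finsum_congr fun j => ?_
  change Finsupp.lsum ℂ f (Finsupp.mapDomain _ (Finsupp.single (j : ℤ) (A.dpow j a))) = _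
  rw [Finsupp.mapDomain_single, Finsupp.lsum_single, show -2 * p + (j : ℤ) = j - 2 * p by ring]

theorem coeff_newY_of_mem (ha : a ∈ A.gr p) (YW : V →ₗ[ℂ] VertexOperator ℂ W) (n : ℤ) (w : W) :
    HVertexOperator.coeff (A.newY YW a) n w = (p.negOnePow : ℤ) • ∑ᶠ j : ℕ,
      HVertexOperator.coeff (YW (A.dpow j a)) (n + 2 * p - j) w := by
  have h := A.lsum_Phi ha fun i => coeffHom YW (n - i) w
  rw [Finsupp.lsum_apply] at h
  simp only [sub_sub_eq_add_sub] at h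
  exact (A.coeff_newY YW a n w).trans h

theorem ncoeff_newY_of_mem (ha : a ∈ A.gr p) {I : ℕ} (hI : ∀ j, I ≤ j → A.dpow j a = 0)
    (YW : V →ₗ[ℂ] VertexOperator ℂ W) (n : ℤ) (w : W) :
    VertexOperator.ncoeff (A.newY YW a) n w = (p.negOnePow : ℤ) • ∑ j ∈ Finset.range I,
      HVertexOperator.coeff (YW (A.dpow j a)) (2 * p - n - 1 - j) w := by
  rw [VertexOperator.ncoeff_apply, A.coeff_newY_of_mem ha,
    finsum_eq_sum_range fun j hj => by rw [hI j hj, coeff_map_zero],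
    show -n - 1 + 2 * p = 2 * p - n - 1 by ring]

theorem coeff_newY_one (YW : V →ₗ[ℂ] VertexOperator ℂ W) (n : ℤ) :
    HVertexOperator.coeff (A.newY YW A.one) n = HVertexOperator.coeff (YW A.one) n := by
  ext w
  rw [A.coeff_newY_of_mem A.one_mem_gr,
    finsum_eq_single _ 0 fun j hj => by rw [A.dpow_one hj, coeff_map_zero], dpow_zero]
  simp

theorem isVacuum_newY_iff (YW : V →ₗ[ℂ] VertexOperator ℂ W) :
    IsVacuum A.one (A.newY YW) ↔ IsVacuum A.one YW := by
  simp only [IsVacuum, coeff_newY_one]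

end VertexOperatorAlgebra

/-! ### The Jacobi identity for the transformed map -/

theorem hasFiniteSupport_sum {M ι κ : Type*} [AddCommGroup M] (s : Finset ι) {f : ι → κ → M}
    (h : ∀ i, (f i).HasFiniteSupport) : (fun k => ∑ i ∈ s, f i k).HasFiniteSupport := by
  refine (s.finite_toSet.biUnion fun i _ => h i).subset fun k hk => ?_
  obtain ⟨i, hi, hne⟩ := Finset.exists_ne_zero_of_sum_ne_zero hk
  exact Set.mem_biUnion hi hne

theorem finsum_zsmul_sum_sum {M ι κ τ : Type*} [AddCommGroup M] (c : ℤ) (s : Finset ι)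
    (t : Finset κ) {f : ι → κ → τ → M} (h : ∀ i j, (f i j).HasFiniteSupport) :
    ∑ᶠ k, c • ∑ i ∈ s, ∑ j ∈ t, f i j k = c • ∑ i ∈ s, ∑ j ∈ t, ∑ᶠ k, f i j k := by
  have ht := fun i => hasFiniteSupport_sum t (h i)
  rw [← smul_finsum' c (hasFiniteSupport_sum s ht), finsum_sum_comm _ _ fun i _ => ht i]
  simp only [finsum_sum_comm _ _ fun j _ => h _ j]

theorem negOnePow_sub_add_natCast_sub_one (s l : ℤ) (r : ℕ) :
    ((s - (l + r) - 1).negOnePow : ℤ) = -((l + s).negOnePow : ℤ) * (-1) ^ r := by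
  rw [Int.negOnePow_sub, Int.negOnePow_sub, Int.negOnePow_add l r, Int.negOnePow_add l s,
    Int.negOnePow_one]
  simp only [Units.val_mul, Units.val_neg, Units.val_one, Int.coe_negOnePow_natCast]
  ring

namespace VertexOperatorAlgebra

variable {V : Type u} [AddCommGroup V] [Module ℂ V] (A : VertexOperatorAlgebra V)
  {W : Type v} [AddCommGroup W] [Module ℂ W] {p q : ℤ} {a b : V} {I J : ℕ}

theorem finsum_ncoeff_newY_newY (ha : a ∈ A.gr p) (hb : b ∈ A.gr q)
    (hI : ∀ j, I ≤ j → A.dpow j a = 0) (hJ : ∀ j, J ≤ j → A.dpow j b = 0)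
    (YW : V →ₗ[ℂ] VertexOperator ℂ W) (w : W) (l m n : ℤ) :
    ∑ᶠ r : ℕ, ((-1) ^ r * Ring.choose l r : ℤ) • VertexOperator.ncoeff (A.newY YW a) (m + l - r)
        (VertexOperator.ncoeff (A.newY YW b) (n + r) w)
      = ((p + q).negOnePow : ℤ) • ∑ i ∈ Finset.range I, ∑ j ∈ Finset.range J,
        expand l (swap (prodCoeff YW (A.dpow i a) (A.dpow j b) w))
          (2 * q - n - l - 1 - j) (2 * p - m - l - 1 - i) := by
  have hterm : ∀ r : ℕ, ((-1) ^ r * Ring.choose l r : ℤ) •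
      VertexOperator.ncoeff (A.newY YW a) (m + l - r)
        (VertexOperator.ncoeff (A.newY YW b) (n + r) w)
      = ((p + q).negOnePow : ℤ) • ∑ i ∈ Finset.range I, ∑ j ∈ Finset.range J,
        ((-1) ^ r * Ring.choose l r : ℤ) • swap (prodCoeff YW (A.dpow i a) (A.dpow j b) w)
          (2 * q - n - l - 1 - j + l - r) (2 * p - m - l - 1 - i + r) := by
    intro r
    generalize ((-1) ^ r * Ring.choose l r : ℤ) = c
    rw [A.ncoeff_newY_of_mem ha hI, A.ncoeff_newY_of_mem hb hJ, smul_comm, Int.negOnePow_add,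
      Units.val_mul, mul_smul]
    simp only [map_zsmul, map_sum, Finset.smul_sum]
    refine Finset.sum_congr rfl fun i _ => Finset.sum_congr rfl fun j _ => ?_
    rw [smul_comm c, swap, prodCoeff,
      show 2 * p - (m + l - r) - 1 - i = 2 * p - m - l - 1 - i + (r : ℤ) by ring,
      show 2 * q - (n + r) - 1 - j = 2 * q - n - l - 1 - j + l - (r : ℤ) by ring]
  rw [finsum_congr hterm, finsum_zsmul_sum_sum _ _ _ fun i j => ?_]
  · rfl
  · obtain ⟨K, hK⟩ := exists_prodCoeff_eq_zero YW (A.dpow i a) (A.dpow j b) w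
    exact hasFiniteSupport_of_le (N := (2 * q - n - 1 - j - K + 1).toNat) fun r hr => by
      rw [swap, hK _ _ (by omega), smul_zero]

theorem exists_ncoeff_dpow_eq_zero (a b : V) (n : ℤ) : ∃ S : ℕ, ∀ i j s : ℕ, S ≤ s →
    VertexOperator.ncoeff (A.Y (A.dpow i a)) (n + s) (A.dpow j b) = 0 := by
  obtain ⟨I, hI⟩ := A.exists_dpow_eq_zero a
  obtain ⟨J, hJ⟩ := A.exists_dpow_eq_zero b
  choose N hN using fun ij : ℕ × ℕ => exists_coeff_eq_zero (A.Y (A.dpow ij.1 a)) (A.dpow ij.2 b)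
  refine ⟨(Finset.range I ×ˢ Finset.range J).sup fun ij => (-N ij - n).toNat, fun i j s hs => ?_⟩
  rcases le_or_gt I i with hi | hi
  · simp [hI i hi]
  rcases le_or_gt J j with hj | hj
  · simp [hJ j hj]
  have hbound := (Finset.le_sup (f := fun ij => (-N ij - n).toNat) (b := (i, j))
    (Finset.mk_mem_product (Finset.mem_range.2 hi) (Finset.mem_range.2 hj))).trans hs
  exact hN (i, j) _ (by omega)

theorem finsum_dpow_ncoeff {M : Type*} [AddCommGroup M] (ha : a ∈ A.gr p) (b : V)
    (hI : ∀ j, I ≤ j → A.dpow j a = 0) (hJ : ∀ j, J ≤ j → A.dpow j b = 0) (n : ℤ)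
    (g : ℕ → V →+ M) : ∑ᶠ N : ℕ, g N (A.dpow N (VertexOperator.ncoeff (A.Y a) n b))
      = ∑ i ∈ Finset.range I, ∑ j ∈ Finset.range J, ∑ᶠ s : ℕ, Ring.choose (2 * p - n - i - 2) s •
        g (i + j + s) (VertexOperator.ncoeff (A.Y (A.dpow i a)) (n + s) (A.dpow j b)) := by
  obtain ⟨S, hS⟩ := A.exists_ncoeff_dpow_eq_zero a b n
  let f : ℕ → ℕ → ℕ → M := fun i j s => Ring.choose (2 * p - n - i - 2) s •
    g (i + j + s) (VertexOperator.ncoeff (A.Y (A.dpow i a)) (n + s) (A.dpow j b))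
  have hfI : ∀ i j s, I ≤ i → f i j s = 0 := fun i j s h => by simp [f, hI i h]
  have hfJ : ∀ i j s, J ≤ j → f i j s = 0 := fun i j s h => by simp [f, hJ j h]
  have hfS : ∀ i j s, S ≤ s → f i j s = 0 := fun i j s h => by
    simp only [f, hS i j s h, map_zero, smul_zero]
  have hterm : ∀ N, g N (A.dpow N (VertexOperator.ncoeff (A.Y a) n b)) = tripleSum N f := by
    intro N
    rw [A.dpow_ncoeff ha, map_tripleSum]
    exact tripleSum_congr fun i j s h => by rw [map_zsmul, ← h]
  have hfin : (fun x : ℕ × ℕ × ℕ => f x.1 x.2.1 x.2.2).HasFiniteSupport :=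
    ((Set.finite_lt_nat I).prod ((Set.finite_lt_nat J).prod (Set.finite_lt_nat S))).subset
      fun x hx => ⟨not_le.1 fun h => hx (hfI _ _ _ h), not_le.1 fun h => hx (hfJ _ _ _ h),
        not_le.1 fun h => hx (hfS _ _ _ h)⟩
  rw [finsum_congr hterm, finsum_tripleSum hfin, finsum_eq_sum_range fun i hi =>
    finsum_eq_zero_of_forall_eq_zero fun j =>
      finsum_eq_zero_of_forall_eq_zero fun s => hfI i j s hi]
  exact Finset.sum_congr rfl fun i _ => finsum_eq_sum_range fun j hj =>
    finsum_eq_zero_of_forall_eq_zero fun s => hfJ i j s hj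

theorem ncoeff_newY_ncoeff (ha : a ∈ A.gr p) (hb : b ∈ A.gr q)
    (hI : ∀ j, I ≤ j → A.dpow j a = 0) (hJ : ∀ j, J ≤ j → A.dpow j b = 0)
    (YW : V →ₗ[ℂ] VertexOperator ℂ W) (w : W) (k n : ℤ) :
    VertexOperator.ncoeff (A.newY YW (VertexOperator.ncoeff (A.Y a) k b)) n w
      = ((p + q - k - 1).negOnePow : ℤ) • ∑ i ∈ Finset.range I, ∑ j ∈ Finset.range J,
        ∑ᶠ s : ℕ, Ring.choose (2 * p - k - i - 2) s • HVertexOperator.coeff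
          (YW (VertexOperator.ncoeff (A.Y (A.dpow i a)) (k + s) (A.dpow j b)))
          (-n - 1 + 2 * (p + q - k - 1) - (i + j + s : ℕ)) w := by
  rw [VertexOperator.ncoeff_apply, A.coeff_newY_of_mem (A.ncoeff_mem_gr ha hb k)]
  congr 1
  exact A.finsum_dpow_ncoeff ha b hI hJ k fun N =>
    (coeffHom YW (-n - 1 + 2 * (p + q - k - 1) - N) w).toAddMonoidHom

theorem finsum_newY_ncoeff (ha : a ∈ A.gr p) (hb : b ∈ A.gr q)
    (hI : ∀ j, I ≤ j → A.dpow j a = 0) (hJ : ∀ j, J ≤ j → A.dpow j b = 0)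
    (YW : V →ₗ[ℂ] VertexOperator ℂ W) (w : W) (l m n : ℤ) :
    ∑ᶠ r : ℕ, Ring.choose m r • VertexOperator.ncoeff
        (A.newY YW (VertexOperator.ncoeff (A.Y a) (l + r) b)) (m + n - r) w
      = -((l + p + q).negOnePow : ℤ) • ∑ i ∈ Finset.range I, ∑ j ∈ Finset.range J,
        ∑ᶠ r : ℕ, Ring.choose (2 * p - m - l - 1 - i - 1) r • HVertexOperator.coeff
          (YW (VertexOperator.ncoeff (A.Y (A.dpow i a)) (l + r) (A.dpow j b)))
          (2 * p - m - l - 1 - i + (2 * q - n - l - 1 - j) - 1 - r) w := by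
  obtain ⟨S, hS⟩ := A.exists_ncoeff_dpow_eq_zero a b l
  let H : ℕ → ℕ → ℕ → W := fun i j R => HVertexOperator.coeff
    (YW (VertexOperator.ncoeff (A.Y (A.dpow i a)) (l + R) (A.dpow j b)))
    (2 * p - m - l - 1 - i + (2 * q - n - l - 1 - j) - 1 - R) w
  have hH : ∀ i j R, S ≤ R → H i j R = 0 := fun i j R hR => by
    simp only [H, hS i j R hR, coeff_map_zero]
  have hterm : ∀ r : ℕ, Ring.choose m r • VertexOperator.ncoeff
        (A.newY YW (VertexOperator.ncoeff (A.Y a) (l + r) b)) (m + n - r) w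
      = -((l + p + q).negOnePow : ℤ) • ∑ i ∈ Finset.range I, ∑ j ∈ Finset.range J,
        ((-1) ^ r * Ring.choose m r : ℤ) •
          ∑ᶠ s : ℕ, Ring.choose (2 * p - l - i - 2 - r) s • H i j (r + s) := by
    intro r
    rw [A.ncoeff_newY_ncoeff ha hb hI hJ, negOnePow_sub_add_natCast_sub_one, ← add_assoc l,
      smul_smul, mul_left_comm, mul_smul, mul_comm (Ring.choose m r)]
    simp only [Finset.smul_sum]
    refine Finset.sum_congr rfl fun i _ => Finset.sum_congr rfl fun j _ => ?_
    simp only [H, Nat.cast_add, add_assoc l]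
    rw [show 2 * p - (l + (r : ℤ)) - i - 2 = 2 * p - l - i - 2 - r by ring]
    congr! 7
    ring
  rw [finsum_congr hterm, finsum_zsmul_sum_sum _ _ _ fun i j => hasFiniteSupport_of_le (N := S)
    fun r hr => by
      rw [finsum_eq_zero_of_forall_eq_zero fun s => by rw [hH _ _ _ (by omega), smul_zero],
        smul_zero]]
  congr 1
  refine Finset.sum_congr rfl fun i _ => Finset.sum_congr rfl fun j _ => ?_
  rw [finsum_choose_smul_finsum_choose_smul m _ (hH i j),
    show 2 * p - l - (i : ℤ) - 2 - m = 2 * p - m - l - 1 - i - 1 by ring]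

end VertexOperatorAlgebra

section Defect

variable {V : Type u} [AddCommGroup V] [Module ℂ V] {W : Type v} [AddCommGroup W] [Module ℂ W]
  (Y : V →ₗ[ℂ] VertexOperator ℂ V) (YW : V →ₗ[ℂ] VertexOperator ℂ W)

theorem hasFiniteSupport_pair (w : W) (c d : ℕ → ℤ) (e : ℤ) (a b : V) :
    (fun i : ℕ => c i • HVertexOperator.coeff (YW a) (d i)
      (HVertexOperator.coeff (YW b) (e - i) w)).HasFiniteSupport := by
  obtain ⟨N, hN⟩ := exists_coeff_eq_zero (YW b) w
  exact hasFiniteSupport_of_le (N := (e - N + 1).toNat) fun i hi => by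
    rw [hN _ (by omega), map_zero, smul_zero]

theorem hasFiniteSupport_iter (w : W) (c d : ℕ → ℤ) (l : ℤ) (a b : V) :
    (fun i : ℕ => c i • HVertexOperator.coeff
      (YW (VertexOperator.ncoeff (Y a) (l + i) b)) (d i) w).HasFiniteSupport := by
  obtain ⟨N, hN⟩ := exists_coeff_eq_zero (Y a) b
  exact hasFiniteSupport_of_le (N := (-N - l).toNat) fun i hi => by
    rw [VertexOperator.ncoeff_apply, hN _ (by omega), coeff_map_zero, smul_zero]

/-- `∑_i c_i Y_W(a, x)_{d_i} Y_W(b, x)_{e-i} w`, as a biadditive map in `a`, `b`; here `Y_W(a, x)_n`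
is the coefficient of `x^n`. -/
noncomputable def pairHom (w : W) (c d : ℕ → ℤ) (e : ℤ) : V →+ V →+ W :=
  AddMonoidHom.mk' (fun a => AddMonoidHom.mk' (fun b => ∑ᶠ i : ℕ, c i •
      HVertexOperator.coeff (YW a) (d i) (HVertexOperator.coeff (YW b) (e - i) w)) fun b b' => by
    rw [← finsum_add_distrib (hasFiniteSupport_pair ..) (hasFiniteSupport_pair ..)]
    simp only [map_add, Pi.add_apply, LinearMap.add_apply, smul_add]) fun a a' => by
    ext b
    simp only [AddMonoidHom.add_apply, AddMonoidHom.mk'_apply]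
    rw [← finsum_add_distrib (hasFiniteSupport_pair ..) (hasFiniteSupport_pair ..)]
    simp only [map_add, Pi.add_apply, LinearMap.add_apply, smul_add]

/-- `∑_i c_i Y_W(a_{l+i} b, x)_{d_i} w`, as a biadditive map in `a`, `b`; here `Y_W(a, x)_n` is the
coefficient of `x^n`. -/
noncomputable def iterHom (w : W) (c d : ℕ → ℤ) (l : ℤ) : V →+ V →+ W :=
  AddMonoidHom.mk' (fun a => AddMonoidHom.mk' (fun b => ∑ᶠ i : ℕ, c i •
      HVertexOperator.coeff (YW (VertexOperator.ncoeff (Y a) (l + i) b)) (d i) w) fun b b' => by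
    rw [← finsum_add_distrib (hasFiniteSupport_iter ..) (hasFiniteSupport_iter ..)]
    simp only [map_add, Pi.add_apply, LinearMap.add_apply, smul_add]) fun a a' => by
    ext b
    simp only [AddMonoidHom.add_apply, AddMonoidHom.mk'_apply]
    rw [← finsum_add_distrib (hasFiniteSupport_iter ..) (hasFiniteSupport_iter ..)]
    simp only [map_add, Pi.add_apply, LinearMap.add_apply, smul_add]

/-- The difference of the two sides of a component of the Jacobi identity. -/
noncomputable def jacobiDefect (w : W) (l m n : ℤ) : V →+ V →+ W :=
  pairHom YW w (fun i => (-1) ^ i * Ring.choose l i) (fun i => -(m + l - i) - 1) (-n - 1)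
    - (l.negOnePow : ℤ) • (pairHom YW w (fun i => (-1) ^ i * Ring.choose l i)
      (fun i => -(n + l - i) - 1) (-m - 1)).flip
    - iterHom Y YW w (Ring.choose m) (fun i => -(m + n - i) - 1) l

/-- The difference of the two sides of a component of `InvJacobi`. -/
noncomputable def invDefect (w : W) (l m n : ℤ) : V →+ V →+ W :=
  (pairHom YW w (fun i => (-1) ^ i * Ring.choose l i) (fun i => n + i) (m + l)).flip
    - (l.negOnePow : ℤ) • pairHom YW w (fun i => (-1) ^ i * Ring.choose l i)
      (fun i => m + i) (n + l)
    - iterHom Y YW w (Ring.choose (m - 1)) (fun i => m + n - 1 - i) l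

theorem jacobiDefect_apply (w : W) (l m n : ℤ) (a b : V) : jacobiDefect Y YW w l m n a b
    = ∑ᶠ i : ℕ, ((-1) ^ i * Ring.choose l i : ℤ) • VertexOperator.ncoeff (YW a) (m + l - i)
        (VertexOperator.ncoeff (YW b) (n + i) w)
      - (l.negOnePow : ℤ) • ∑ᶠ i : ℕ, ((-1) ^ i * Ring.choose l i : ℤ) •
        VertexOperator.ncoeff (YW b) (n + l - i) (VertexOperator.ncoeff (YW a) (m + i) w)
      - ∑ᶠ i : ℕ, Ring.choose m i •
        VertexOperator.ncoeff (YW (VertexOperator.ncoeff (Y a) (l + i) b)) (m + n - i) w := by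
  have hindex : ∀ (k : ℤ) (i : ℕ), -(k + i) - 1 = -k - 1 - i := fun k i => by ring
  simp only [VertexOperator.ncoeff_apply (YW _), hindex]
  rfl

theorem jacobiIdentity_iff :
    JacobiIdentity Y YW ↔ ∀ a b w l m n, jacobiDefect Y YW w l m n a b = 0 := by
  have hsmul : ∀ (l : ℤ) (f : ℕ → W), (l.negOnePow : ℤ) • ∑ᶠ i, f i
      = ∑ᶠ i, (l.negOnePow : ℤ) • f i := fun l f =>
    AddMonoidHom.map_finsum_of_injective (zsmulAddGroupHom (l.negOnePow : ℤ))
      (MulAction.injective l.negOnePow) f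
  simp only [jacobiDefect_apply, hsmul, smul_smul, sub_eq_zero, JacobiIdentity,
    ← Int.cast_smul_eq_zsmul ℂ, Int.cast_mul, Int.cast_negOnePow, Int.cast_pow, Int.cast_neg,
    Int.cast_one, mul_assoc]

theorem invDefect_apply (w : W) (l m n : ℤ) (a b : V) : invDefect Y YW w l m n a b
    = expand l (swap (prodCoeff YW b a w)) m n
      - (l.negOnePow : ℤ) • expand l (swap (prodCoeff YW a b w)) n m
      - ∑ᶠ i : ℕ, Ring.choose (m - 1) i •
        HVertexOperator.coeff (YW (VertexOperator.ncoeff (Y a) (l + i) b)) (m + n - 1 - i) w :=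
  rfl

theorem invJacobi_iff (a b : V) :
    InvJacobi Y YW a b ↔ ∀ w l m n, invDefect Y YW w l m n a b = 0 := by
  simp only [invDefect_apply, sub_eq_zero, InvJacobi]

end Defect

namespace VertexOperatorAlgebra

variable {V : Type u} [AddCommGroup V] [Module ℂ V] (A : VertexOperatorAlgebra V)
  {W : Type v} [AddCommGroup W] [Module ℂ W] {p q : ℤ} {a b : V} {I J : ℕ}

theorem biadditive_eq_zero {M : Type*} [AddCommGroup M] (D : V →+ V →+ M)
    (h : ∀ p q, ∀ a ∈ A.gr p, ∀ b ∈ A.gr q, D a b = 0) (a b : V) : D a b = 0 := by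
  refine A.gr_induction (P := fun a => D a b = 0) (by simp)
    (fun a a' h h' => by rw [map_add, AddMonoidHom.add_apply, h, h', add_zero])
    (fun p a ha => ?_) a
  exact A.gr_induction (P := fun b => D a b = 0) (by simp)
    (fun b b' h h' => by rw [map_add, h, h', add_zero]) (fun q b hb => h p q a ha b hb) b

theorem dpow_induction {P : V → V → Prop} (zero_left : ∀ b, P 0 b) (zero_right : ∀ a, P a 0)
    (step : ∀ p q, ∀ a ∈ A.gr p, ∀ b ∈ A.gr q,
      (∀ i j, (i, j) ≠ (0, 0) → P (A.dpow i a) (A.dpow j b)) → P a b)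
    (ha : a ∈ A.gr p) (hb : b ∈ A.gr q) : P a b := by
  obtain ⟨M, hM⟩ := A.lower_truncation
  induction hN : (p - M + 1).toNat + (q - M + 1).toNat using Nat.strong_induction_on
    generalizing p q a b with
  | _ N ih =>
    rcases lt_or_ge p M with hp | hp
    · rw [hM p hp, Submodule.mem_bot] at ha
      exact ha ▸ zero_left b
    rcases lt_or_ge q M with hq | hq
    · rw [hM q hq, Submodule.mem_bot] at hb
      exact hb ▸ zero_right a
    refine step p q a ha b hb fun i j hij => ih _ ?_ (A.dpow_mem_gr ha i) (A.dpow_mem_gr hb j) rfl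
    rw [Ne, Prod.mk_inj] at hij
    omega

theorem jacobiDefect_newY (ha : a ∈ A.gr p) (hb : b ∈ A.gr q)
    (hI : ∀ j, I ≤ j → A.dpow j a = 0) (hJ : ∀ j, J ≤ j → A.dpow j b = 0)
    (YW : V →ₗ[ℂ] VertexOperator ℂ W) (w : W) (l m n : ℤ) :
    jacobiDefect A.Y (A.newY YW) w l m n a b
      = -((l + p + q).negOnePow : ℤ) • ∑ i ∈ Finset.range I, ∑ j ∈ Finset.range J,
        invDefect A.Y YW w l (2 * p - m - l - 1 - i) (2 * q - n - l - 1 - j)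
          (A.dpow i a) (A.dpow j b) := by
  rw [jacobiDefect_apply, A.finsum_ncoeff_newY_newY ha hb hI hJ,
    A.finsum_ncoeff_newY_newY hb ha hJ hI, A.finsum_newY_ncoeff ha hb hI hJ, Finset.sum_comm
      (s := Finset.range J)]
  simp only [invDefect_apply, Finset.sum_sub_distrib, ← Finset.smul_sum]
  have hsign : ((l + p + q).negOnePow : ℤ) = l.negOnePow * (p + q).negOnePow := by
    rw [add_assoc, Int.negOnePow_add, Units.val_mul]
  have hsq : (l.negOnePow : ℤ) * l.negOnePow = 1 := by
    rw [← Units.val_mul, Int.units_mul_self, Units.val_one]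
  rw [smul_sub, smul_sub, smul_smul, smul_smul, add_comm q p, hsign,
    show -((l.negOnePow : ℤ) * ((p + q).negOnePow : ℤ)) * (l.negOnePow : ℤ)
      = -((p + q).negOnePow : ℤ) by linear_combination -((p + q).negOnePow : ℤ) * hsq]
  module

/-- The formula `jacobiDefect_newY` is unitriangular, up to sign, with respect to the weights of `a`
and `b`, so it can be inverted by induction on the weights. -/
theorem invJacobi_of_jacobiIdentity_newY {YW : V →ₗ[ℂ] VertexOperator ℂ W}
    (h : JacobiIdentity A.Y (A.newY YW)) (ha : a ∈ A.gr p) (hb : b ∈ A.gr q) :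
    InvJacobi A.Y YW a b := by
  simp only [jacobiIdentity_iff] at h
  refine A.dpow_induction (fun b => ?_) (fun a => ?_) (fun p q a ha b hb ih => ?_) ha hb
  · simp [invJacobi_iff]
  · simp [invJacobi_iff]
  obtain ⟨I, hI⟩ := A.exists_dpow_eq_zero a
  obtain ⟨J, hJ⟩ := A.exists_dpow_eq_zero b
  rw [invJacobi_iff]
  intro w l m n
  have hsum := A.jacobiDefect_newY ha hb (fun j hj => hI j (Nat.le_of_succ_le hj))
    (fun j hj => hJ j (Nat.le_of_succ_le hj)) YW w l (2 * p - m - l - 1) (2 * q - n - l - 1)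
  rw [h, ← Finset.sum_product', Finset.sum_eq_single_of_mem (0, 0) (by simp) fun ij _ hij =>
      (invJacobi_iff ..).1 (ih ij.1 ij.2 hij) _ _ _ _, A.dpow_zero, A.dpow_zero, neg_smul,
    eq_comm, neg_eq_zero, ← Units.smul_def, smul_eq_zero_iff_eq] at hsum
  have hcancel : ∀ r s : ℤ, 2 * r - (2 * r - s - l - 1) - l - 1 = s := fun r s => by ring
  simpa only [Nat.cast_zero, sub_zero, hcancel] using hsum

theorem jacobiIdentity_newY_iff (YW : V →ₗ[ℂ] VertexOperator ℂ W) :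
    JacobiIdentity A.Y (A.newY YW) ↔ ∀ a b, InvJacobi A.Y YW a b := by
  constructor
  · intro h a b
    rw [invJacobi_iff]
    exact fun w l m n => A.biadditive_eq_zero _ (fun p q a ha b hb =>
      (invJacobi_iff ..).1 (A.invJacobi_of_jacobiIdentity_newY h ha hb) w l m n) a b
  · intro h
    rw [jacobiIdentity_iff]
    refine fun a b w l m n => A.biadditive_eq_zero _ (fun p q a ha b hb => ?_) a b
    obtain ⟨I, hI⟩ := A.exists_dpow_eq_zero a
    obtain ⟨J, hJ⟩ := A.exists_dpow_eq_zero b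
    rw [A.jacobiDefect_newY ha hb hI hJ, Finset.sum_eq_zero, smul_zero]
    exact fun i _ => Finset.sum_eq_zero fun j _ => (invJacobi_iff ..).1 (h _ _) _ _ _ _

theorem isPhiModule_iff_isModule_newY (YW : V →ₗ[ℂ] VertexOperator ℂ W) :
    IsPhiModule phi A.toVertexAlgebra YW ↔ IsModule A.toVertexAlgebra (A.newY YW) := by
  have hmodule : IsModule A.toVertexAlgebra (A.newY YW) ↔
      IsVacuum A.one YW ∧ ∀ a b, InvJacobi A.Y YW a b := by
    rw [← A.isVacuum_newY_iff, ← A.jacobiIdentity_newY_iff]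
    exact ⟨fun h => ⟨h.vacuum, h.jacobi⟩, fun h => ⟨h.1, h.2⟩⟩
  rw [isPhiModule_iff, hmodule]
  exact and_congr_right fun hvac => exists_isInvAssoc_iff _ hvac

end VertexOperatorAlgebra

/-! ### The inverse of `Y_W ↦ Y_W^new` -/

theorem sum_antidiagonal_neg_one_pow_choose (N : ℕ) :
    ∑ ij ∈ Finset.HasAntidiagonal.antidiagonal N, ((-1) ^ ij.1 * (N.choose ij.1) : ℤ)
      = if N = 0 then 1 else 0 := by
  rw [← Int.alternating_sum_range_choose, Finset.Nat.sum_antidiagonal_eq_sum_range_succ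
    (f := fun i _ => ((-1) ^ i * (N.choose i) : ℤ))]

namespace VertexOperatorAlgebra

variable {V : Type u} [AddCommGroup V] [Module ℂ V] (A : VertexOperatorAlgebra V)
  {W : Type v} [AddCommGroup W] [Module ℂ W]

/-- The inverse `Y_W^old(v, x) = Y_W(e^{x⁻¹L(1)} (-x²)^{L(0)} v, x)` of the transformation `newY`.
Its argument is obtained from `e^{xL(1)} (-x⁻²)^{L(0)} v` by replacing `x` with `x⁻¹`. -/
noncomputable def oldY (YW : V →ₗ[ℂ] VertexOperator ℂ W) : V →ₗ[ℂ] VertexOperator ℂ W :=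
  (Finsupp.lsum ℂ fun i : ℤ =>
    (LinearMap.lsmul (LaurentSeries ℂ) (HahnModule ℤ ℂ W)
      (HahnSeries.single (-i) 1) |>.restrictScalars ℂ).compRight ℂ ∘ₗ YW).comp A.Phi

theorem coeff_oldY (YW : V →ₗ[ℂ] VertexOperator ℂ W) (a : V) (n : ℤ) (w : W) :
    HVertexOperator.coeff (A.oldY YW a) n w
      = Finsupp.lsum ℂ (fun i => coeffHom YW (n + i) w) (A.Phi a) := by
  rw [oldY, LinearMap.comp_apply]
  induction A.Phi a using Finsupp.induction_linear with
  | zero => simp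
  | add f g hf hg =>
    rw [map_add, map_add, map_add, ← hf, ← hg]
    rfl
  | single i b =>
    rw [Finsupp.lsum_single, Finsupp.lsum_single]
    change ((HahnModule.of ℂ).symm (HahnSeries.single (-i) (1 : ℂ) • YW b w)).coeff n
      = ((HahnModule.of ℂ).symm (YW b w)).coeff (n + i)
    simpa using HahnModule.coeff_single_smul_vadd (r := (1 : ℂ)) (x := YW b w) (a := n + i)
      (b := -i)

theorem coeff_oldY_of_mem {p : ℤ} {a : V} (ha : a ∈ A.gr p) (YW : V →ₗ[ℂ] VertexOperator ℂ W)
    (n : ℤ) (w : W) : HVertexOperator.coeff (A.oldY YW a) n w = (p.negOnePow : ℤ) • ∑ᶠ j : ℕ,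
      HVertexOperator.coeff (YW (A.dpow j a)) (n - 2 * p + j) w := by
  have h := A.lsum_Phi ha fun i => coeffHom YW (n + i) w
  simp only [← add_sub_assoc, add_sub_right_comm] at h
  exact (A.coeff_oldY YW a n w).trans h

theorem sum_antidiagonal_dpow_dpow (N : ℕ) (a : V) :
    ∑ ij ∈ Finset.HasAntidiagonal.antidiagonal N, (-1 : ℤ) ^ ij.1 • A.dpow ij.2 (A.dpow ij.1 a)
      = if N = 0 then a else 0 := by
  calc _ = ∑ ij ∈ Finset.HasAntidiagonal.antidiagonal N,
        ((-1) ^ ij.1 * (N.choose ij.1) : ℤ) • A.dpow N a := Finset.sum_congr rfl fun ij hij => by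
          rw [dpow_dpow, smul_smul, add_comm ij.2, ← Nat.choose_symm_add,
            Finset.HasAntidiagonal.mem_antidiagonal.1 hij]
    _ = if N = 0 then a else 0 := by
        rw [← Finset.sum_smul, sum_antidiagonal_neg_one_pow_choose]
        split_ifs with hN
        · rw [hN, dpow_zero, one_smul]
        · rw [zero_smul]

theorem finsum_dpow_dpow (p : ℤ) (a : V) {M : Type*} [AddCommGroup M] (g : ℕ → V →+ M) :
    (p.negOnePow : ℤ) • ∑ᶠ i : ℕ, ((p - i).negOnePow : ℤ) • ∑ᶠ j : ℕ,
      g (i + j) (A.dpow j (A.dpow i a)) = g 0 a := by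
  obtain ⟨I, hI⟩ := A.exists_dpow_eq_zero a
  have hdpow : ∀ i j, I ≤ i + j → A.dpow j (A.dpow i a) = 0 := fun i j hij => by
    rw [dpow_dpow, hI _ (by omega), smul_zero]
  let f : ℕ × ℕ → M := fun ij =>
    g (ij.1 + ij.2) ((-1 : ℤ) ^ ij.1 • A.dpow ij.2 (A.dpow ij.1 a))
  have hzero : ∀ ij : ℕ × ℕ, I ≤ ij.1 + ij.2 → f ij = 0 := fun ij h => by
    simp only [f, hdpow _ _ h, smul_zero, map_zero]
  have hf : f.HasFiniteSupport := ((Set.finite_lt_nat I).prod (Set.finite_lt_nat I)).subset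
    fun ij hij => ⟨not_le.1 fun h => hij (hzero ij (h.trans (Nat.le_add_right _ _))),
      not_le.1 fun h => hij (hzero ij (h.trans (Nat.le_add_left _ _)))⟩
  have hsign : ∀ i : ℕ, (p.negOnePow : ℤ) * ((p - i).negOnePow : ℤ) = (-1) ^ i := fun i => by
    rw [Int.negOnePow_sub, ← Units.val_mul, ← mul_assoc, Int.units_mul_self, one_mul,
      Int.coe_negOnePow_natCast]
  calc (p.negOnePow : ℤ) • ∑ᶠ i : ℕ, ((p - i).negOnePow : ℤ) • ∑ᶠ j : ℕ,
        g (i + j) (A.dpow j (A.dpow i a))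
    _ = ∑ᶠ (i) (j), f (i, j) := by
        rw [smul_finsum' _ (hasFiniteSupport_of_le (N := I) fun i hi => by
          rw [finsum_eq_zero_of_forall_eq_zero fun j => by
            rw [hdpow _ _ (by omega), map_zero], smul_zero])]
        refine finsum_congr fun i => ?_
        rw [smul_smul, hsign, smul_finsum' _ (hasFiniteSupport_of_le (N := I) fun j hj => by
          rw [hdpow _ _ (by omega), map_zero])]
        simp only [f, map_zsmul]
    _ = ∑ᶠ N, ∑ ij ∈ Finset.HasAntidiagonal.antidiagonal N, f ij :=
        (finsum_sum_antidiagonal_eq_finsum_finsum hf).symm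
    _ = ∑ᶠ N : ℕ, g N (if N = 0 then a else 0) := finsum_congr fun N => by
        rw [← A.sum_antidiagonal_dpow_dpow, map_sum]
        exact Finset.sum_congr rfl fun ij hij => by
          simp only [f, Finset.HasAntidiagonal.mem_antidiagonal.1 hij]
    _ = g 0 a := by
        rw [finsum_eq_single _ 0 fun N hN => by rw [if_neg hN, map_zero], if_pos rfl]

theorem ext_of_mem_gr {Y₁ Y₂ : V →ₗ[ℂ] VertexOperator ℂ W} (h : ∀ p, ∀ a ∈ A.gr p, ∀ n w,
    HVertexOperator.coeff (Y₁ a) n w = HVertexOperator.coeff (Y₂ a) n w) : Y₁ = Y₂ :=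
  LinearMap.ext <| A.gr_induction (by simp) (fun a b ha hb => by rw [map_add, map_add, ha, hb])
    fun p a ha => HVertexOperator.coeff_inj <| funext fun n => LinearMap.ext (h p a ha n)

theorem oldY_newY (YW : V →ₗ[ℂ] VertexOperator ℂ W) : A.oldY (A.newY YW) = YW := by
  refine A.ext_of_mem_gr fun p a ha n w => ?_
  have hindex : ∀ i j : ℕ, n - 2 * p + i + 2 * (p - i) - j = n - (i + j : ℕ) := fun i j => by
    push_cast; ring
  simp only [A.coeff_oldY_of_mem ha, A.coeff_newY_of_mem (A.dpow_mem_gr ha _), hindex]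
  refine (A.finsum_dpow_dpow p a fun i => (coeffHom YW (n - i) w).toAddMonoidHom).trans ?_
  rw [Nat.cast_zero, sub_zero]
  rfl

theorem newY_oldY (YW : V →ₗ[ℂ] VertexOperator ℂ W) : A.newY (A.oldY YW) = YW := by
  refine A.ext_of_mem_gr fun p a ha n w => ?_
  have hindex : ∀ i j : ℕ, n + 2 * p - i - 2 * (p - i) + j = n + (i + j : ℕ) := fun i j => by
    push_cast; ring
  simp only [A.coeff_newY_of_mem ha, A.coeff_oldY_of_mem (A.dpow_mem_gr ha _), hindex]
  refine (A.finsum_dpow_dpow p a fun i => (coeffHom YW (n + i) w).toAddMonoidHom).trans ?_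
  rw [Nat.cast_zero, add_zero]
  rfl

end VertexOperatorAlgebra

section Functors

variable {V : Type u} [AddCommGroup V] [Module ℂ V] (A : VertexOperatorAlgebra V)

/-- The assignment `(W, Y_W) ↦ (W, Y_W^old)`, identical on linear maps; the inverse of
`newFunctor`. -/
noncomputable def oldFunctor : FieldSpace.{u, v} V ⥤ FieldSpace.{u, v} V where
  obj M := { W := M.W, YW := A.oldY M.YW }
  map {M N} f :=
    { map := f.map
      comm := fun a n w => by
        simp only [A.coeff_oldY, Finsupp.lsum_apply, Finsupp.sum, map_sum]
        exact Finset.sum_congr rfl fun i _ => f.comm _ _ _ }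

theorem FieldSpace.hom_heq {M₁ M₂ N₁ N₂ : FieldSpace.{u, v} V} (hM : M₁ = M₂) (hN : N₁ = N₂)
    {f : M₁ ⟶ N₁} {g : M₂ ⟶ N₂} (h : HEq (FieldSpace.Hom.map f) (FieldSpace.Hom.map g)) :
    HEq f g := by
  subst hM hN
  exact heq_of_eq (FieldSpace.Hom.ext (eq_of_heq h))

theorem oldFunctor_obj_newFunctor_obj (M : FieldSpace.{u, v} V) :
    (oldFunctor A).obj ((newFunctor A).obj M) = M := by
  simp only [oldFunctor, newFunctor, A.oldY_newY]

theorem newFunctor_obj_oldFunctor_obj (M : FieldSpace.{u, v} V) :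
    (newFunctor A).obj ((oldFunctor A).obj M) = M := by
  simp only [oldFunctor, newFunctor, A.newY_oldY]

theorem newFunctor_comp_oldFunctor : newFunctor.{u, v} A ⋙ oldFunctor A = 𝟭 _ :=
  CategoryTheory.Functor.hext (oldFunctor_obj_newFunctor_obj A) fun M N _ =>
    FieldSpace.hom_heq (oldFunctor_obj_newFunctor_obj A M) (oldFunctor_obj_newFunctor_obj A N)
      HEq.rfl

theorem oldFunctor_comp_newFunctor : oldFunctor.{u, v} A ⋙ newFunctor A = 𝟭 _ :=
  CategoryTheory.Functor.hext (newFunctor_obj_oldFunctor_obj A) fun M N _ =>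
    FieldSpace.hom_heq (newFunctor_obj_oldFunctor_obj A M) (newFunctor_obj_oldFunctor_obj A N)
      HEq.rfl

theorem isModule_newFunctor_obj (M : PhiModCat.{u, v} phi A.toVertexAlgebra) :
    IsModule A.toVertexAlgebra ((newFunctor A).obj M.obj).YW :=
  (A.isPhiModule_iff_isModule_newY _).1 M.property

theorem isPhiModule_oldFunctor_obj (M : ModCat.{u, v} A.toVertexAlgebra) :
    IsPhiModule phi A.toVertexAlgebra ((oldFunctor A).obj M.obj).YW :=
  (A.isPhiModule_iff_isModule_newY _).2 ((A.newY_oldY M.obj.YW).symm ▸ M.property)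

theorem fullSubcategory_functor_ext {C D : Type*} [Category C] [Category D] {P : ObjectProperty D}
    {F G : C ⥤ P.FullSubcategory} (h : F ⋙ P.ι = G ⋙ P.ι) : F = G := by
  refine CategoryTheory.Functor.ext
    (fun X => ObjectProperty.FullSubcategory.ext (CategoryTheory.Functor.congr_obj h X))
    fun X Y f => P.ι.map_injective ?_
  rw [Functor.map_comp, Functor.map_comp, eqToHom_map, eqToHom_map]
  exact CategoryTheory.Functor.congr_hom h f

end Functors

end VertexOp

theorem proposition3p8 {V : Type u} [AddCommGroup V] [Module ℂ V]
    (A : VertexOp.VertexOperatorAlgebra V) :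
    (∀ (W : Type v) [AddCommGroup W] [Module ℂ W] (YW : V →ₗ[ℂ] VertexOperator ℂ W),
      VertexOp.IsVacuum A.one YW →
        (VertexOp.IsPhiModule VertexOp.phi A.toVertexAlgebra YW ↔
          VertexOp.IsModule A.toVertexAlgebra (A.newY YW))) ∧
    ∃ (F : VertexOp.PhiModCat.{u, v} VertexOp.phi A.toVertexAlgebra ⥤
          VertexOp.ModCat.{u, v} A.toVertexAlgebra)
      (G : VertexOp.ModCat.{u, v} A.toVertexAlgebra ⥤
          VertexOp.PhiModCat.{u, v} VertexOp.phi A.toVertexAlgebra),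
      F ⋙ ObjectProperty.ι _ = ObjectProperty.ι _ ⋙ VertexOp.newFunctor.{u, v} A ∧
      F ⋙ G = 𝟭 _ ∧ G ⋙ F = 𝟭 _ := by
  refine ⟨fun W _ _ YW _ => A.isPhiModule_iff_isModule_newY YW,
    ObjectProperty.lift _ (ObjectProperty.ι _ ⋙ VertexOp.newFunctor A)
      (VertexOp.isModule_newFunctor_obj A),
    ObjectProperty.lift _ (ObjectProperty.ι _ ⋙ VertexOp.oldFunctor A)
      (VertexOp.isPhiModule_oldFunctor_obj A), rfl, ?_, ?_⟩
  · exact VertexOp.fullSubcategory_functor_ext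
      (congrArg (ObjectProperty.ι _ ⋙ ·) (VertexOp.newFunctor_comp_oldFunctor A))
  · exact VertexOp.fullSubcategory_functor_ext
      (congrArg (ObjectProperty.ι _ ⋙ ·) (VertexOp.oldFunctor_comp_newFunctor A))
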